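/- **Conventions.** Graphs are directed. For graphs $G,H$: the Cartesian product $G\,\square\,H$ has vertex set $V(G)\times V(H)$ and edges $((v,u),(v',u'))$ with ($v=v'$ and $(u,u')\in E(H)$) or ($u=u'$ and $(v,v')\in E(G)$); the tensor product $G\times H$ has the same vertices and edges with $(v,v')\in E(G)$ and $(u,u')\in E(H)$; $G\cup H$ has vertex set $V(G)\cup V(H)$ and edge set $E(G)\cup E(H)$. Tuples are flattened. A *factored graph* is given by a formula built with these three binary operations from input graphs on vertex sets $\{0,\dots,m-1\}$; it has *complexity* $(n,k)$ if the formula has $k-1$ operations and all input graphs have at most $n$ vertices. Its vertices, which are tuples of integers, are ordered lexicographically. The LFMIS of an ordered graph is its lexicographically first maximal independent set (independent: no edge in either direction between two distinct members). A Turing machine $M$ is deterministic with a single tape, infinite to the right with cells $1,2,\dots$: states $Q$, tape alphabet $\Gamma\ni\perp$ (blank), input alphabet $\Sigma\subseteq\Gamma\setminus\{\perp\}$, transition function $\delta=(\delta_Q,\delta_\Gamma,\delta_d)$ into $Q\times\Gamma\times\{L,R\}$, start state $q_0$, and halting states $F=\{q_{\rm accept},q_{\rm reject}\}$, $q_{\rm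 accept}\ne q_{\rm reject}$. It stops on entering a halting state; a machine that moves left from cell $1$ stops without having halted. Time step $1$ is the initial configuration. $M$ is *normalized* if, whenever it halts, its head is on cell $1$ and this cell contains $\perp$. **The graph $G(M,x,T)$.** Let $x=(x_1,\dots,x_n)\in\Sigma^n$. Put $Q^*=Q\cup\{*\}$, $\dot Q=Q^*\cup\{\dot q_0\}$, $\dot\Gamma=\Gamma\cup\{\dot x_1,\dots,\dot x_n\}$ with $\dot x_1,\dots,\dot x_n$ new and distinct. The vertices are the tuples $(i,j,q,a)\in[T]\times[T]\times\dot Q\times\dot\Gamma$, ordered lexicographically, where $\dot q_0\prec *\prec q$ for $q\in Q$ and $\dot x_1\prec\dots\prec\dot x_n\prec\perp\prec a$ for $a\in\Gamma\setminus\{\perp\}$, with any order inside $Q$ and $\Gamma\setminus\{\perp\}$. The supernode $S_{i,j}$ is the set of the vertices with first coordinates $i,j$. For $(q,a)\in Q^*\times\Gamma$ let $$\mathcal C_V(q,a)=\begin{cases}\{(*,\delta_\Gamma(q,a))\}&q\in Q\setminus F\\ \{(q,a)\}&q\in F\\ Q^*\times\{a\}&q=*\end{cases}\qquad \mathcal C_R(q,a)=\begin{cases}\{\delta_Q(q,a)\}\times\Gamma&q\in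 Q\setminus F,\ \delta_d(q,a)=R\\ \{*\}\times\Gamma&q\in Q\setminus F,\ \delta_d(q,a)=L\\ Q^*\times\Gamma&q\in F\cup\{*\}\end{cases}$$ and let $\mathcal C_L$ be $\mathcal C_R$ with the roles of $L$ and $R$ in the conditions on $\delta_d$ exchanged; on special symbols, first replace $\dot q_0$ by $q_0$ and $\dot x_i$ by $x_i$. Let $\mathcal C_H(q,\dot x_i)=Q^*\times(\Gamma\cup\{\dot x_{i+1}\})$ for $1\le i<n$ and $\mathcal C_H(q,a)=Q^*\times\Gamma$ for all other $a\in\dot\Gamma$. The edges are: all pairs of distinct vertices of one supernode; and, for $D\in\{V,H,R,L\}$, the pairs $((i,j,q,a),(i',j',q',a'))$ with $(i',j')-(i,j)=(1,0),(0,1),(1,1),(1,-1)$ respectively and $(q',a')\notin\mathcal C_D(q,a)$. **The formula $F(M,x,b,k)$.** For $b\ge2$, $k\ge1$ and $T=b^k$, identify $[T]$ with $\{0,\dots,b-1\}^k$ through the base-$b$ expansion of $i-1$, most significant digit first. On $\{0,\dots,b-1\}$ let $A$ have no edges, $B$ the edges $(i,i+1)$, $C$ the single edge $(b-1,0)$.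 Let $\overline{K_T}=A^{\square k}$, let $\vec\pi_T=\bigcup_{i=0}^{k-1}A^{\square(k-i-1)}\,\square\,(B\times C^{\times i})$, and let $\overleftarrow\pi_T$ be the same with the edges of $B$ and $C$ reversed. Let $G_V=\vec\pi_T\,\square\,\overline{K_T}$, $G_H=\overline{K_T}\,\square\,\vec\pi_T$, $G_R=\vec\pi_T\times\vec\pi_T$, $G_L=\vec\pi_T\times\overleftarrow\pi_T$. Let $R_D$ be the graph on $\dot Q\times\dot\Gamma$ (numbered in lexicographic order) with an edge from $(q,a)$ to $(q',a')$ iff $(q',a')\notin\mathcal C_D(q,a)$, and $K$ the complete graph on $\dot Q\times\dot\Gamma$. Then $$F(M,x,b,k)=\big((\overline{K_T}\,\square\,\overline{K_T})\,\square\,K\big)\cup(G_V\times R_V)\cup(G_H\times R_H)\cup(G_R\times R_R)\cup(G_L\times R_L).$$ **Theorem.** 1. If $M$ is normalized, $n\ge1$, and $M$ halts on $x\in\Sigma^n$ at some time step $t\le T$, then $M$ accepts $x$ if and only if the vertex $(T,1,q_{\rm accept},\perp)$ belongs to the LFMIS of $G(M,x,T)$. 2. For all $M$, $x\in\Sigma^n$,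 $b\ge2$ and $k\ge1$, the factored graph $F(M,x,b,k)$ is $G(M,x,b^k)$, with the same edges and the same vertex order, and it has complexity $\big(\max\{b,(|Q|+2)(|\Gamma|+n)\},\,6k^2+4k+5\big)$. 3. Let $\ell\ge1$ and let $M$ be a normalized Turing machine that decides a language $L$ in time $O(n^\ell)$. There is a constant $C$ such that for every input $x$ of size $n\ge1$, with $b=\max\{n,2\}$, $M$ halts on $x$ at a time step $t\le C n^\ell$, and there is $k\ge1$ with $Cn^\ell\le b^k<b\cdot Cn^\ell$ such that the factored graph $G_x=F(M,x,b,k)$ has complexity $(O(n),O(\ell^2))$, and its vertex $u=(b^k,1,q_{\rm accept},\perp)$ belongs to the LFMIS of $G_x$ if and only if $M$ accepts $x$, that is, if and only if $x\in L$. The constant in $O(n)$ depends only on $M$. The bound $O(\ell^2)$ holds for all $n\ge1$ with a constant that does not depend on $x$, and with an absolute constant for all $n\ge N$, where $N$ does not depend on $x$. 4. Every language decided by a Turing machine in time $O(n^\ell)$, $\ell\ge1$, is decided in time $O(n^\ell)$ by a normalized Turing machine. -/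

import Mathlib

open Filter Asymptotics

namespace FactoredLFMIS

/-! ### Directed graphs, products, unions -/

/-- A directed graph whose vertices form a subset of an ambient type. -/
structure DGraph (V : Type) where
  verts : Set V
  Edge : V → V → Prop
  edge_mem : ∀ {u v : V}, Edge u v → u ∈ verts ∧ v ∈ verts

/-- Cartesian product of graphs on flattened tuples: the pair `(u, v)` is the concatenation
`u ++ v`. -/
def DGraph.cart (G H : DGraph (List ℕ)) : DGraph (List ℕ) where
  verts := {w | ∃ u ∈ G.verts, ∃ v ∈ H.verts, w = u ++ v}
  Edge w w' := ∃ u ∈ G.verts, ∃ v ∈ H.verts, ∃ u' ∈ G.verts, ∃ v' ∈ H.verts,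
    w = u ++ v ∧ w' = u' ++ v' ∧ ((u = u' ∧ H.Edge v v') ∨ (v = v' ∧ G.Edge u u'))
  edge_mem := by
    rintro w w' ⟨u, hu, v, hv, u', hu', v', hv', h, h', -⟩
    exact ⟨⟨u, hu, v, hv, h⟩, ⟨u', hu', v', hv', h'⟩⟩

/-- Tensor product of graphs on flattened tuples. -/
def DGraph.tensor (G H : DGraph (List ℕ)) : DGraph (List ℕ) where
  verts := {w | ∃ u ∈ G.verts, ∃ v ∈ H.verts, w = u ++ v}
  Edge w w' := ∃ u ∈ G.verts, ∃ v ∈ H.verts, ∃ u' ∈ G.verts, ∃ v' ∈ H.verts,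
    w = u ++ v ∧ w' = u' ++ v' ∧ G.Edge u u' ∧ H.Edge v v'
  edge_mem := by
    rintro w w' ⟨u, hu, v, hv, u', hu', v', hv', h, h', -⟩
    exact ⟨⟨u, hu, v, hv, h⟩, ⟨u', hu', v', hv', h'⟩⟩

/-- Union of graphs: union of the vertex sets and union of the edge sets. -/
def DGraph.union {V : Type} (G H : DGraph V) : DGraph V where
  verts := G.verts ∪ H.verts
  Edge u v := G.Edge u v ∨ H.Edge u v
  edge_mem := by
    rintro u v (h | h)
    · exact ⟨Or.inl (G.edge_mem h).1, Or.inl (G.edge_mem h).2⟩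
    · exact ⟨Or.inr (H.edge_mem h).1, Or.inr (H.edge_mem h).2⟩

/-- `φ` identifies `G`, ordered by `lt`, with `H`, ordered by `lt'`: it is a bijection between
the vertex sets that preserves and reflects the edges and the order. -/
def DGraph.IsOrderedIso {V W : Type} (G : DGraph V) (lt : V → V → Prop)
    (H : DGraph W) (lt' : W → W → Prop) (φ : V → W) : Prop :=
  Set.BijOn φ G.verts H.verts ∧
    ∀ u ∈ G.verts, ∀ v ∈ G.verts,
      (G.Edge u v ↔ H.Edge (φ u) (φ v)) ∧ (lt u v ↔ lt' (φ u) (φ v))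

/-! ### Lexicographically first maximal independent set -/

def DGraph.IsIndep {V : Type} (G : DGraph V) (I : Set V) : Prop :=
  I ⊆ G.verts ∧ ∀ u ∈ I, ∀ v ∈ I, u ≠ v → ¬ G.Edge u v

def DGraph.IsMaxIndep {V : Type} (G : DGraph V) (I : Set V) : Prop :=
  G.IsIndep I ∧ ∀ J : Set V, I ⊂ J → ¬ G.IsIndep J

/-- `I` is a maximal independent set that precedes every other maximal independent set `J`
lexicographically: the first vertex on which `I` and `J` differ belongs to `I`. -/
def DGraph.IsLFMIS {V : Type} (G : DGraph V) (lt : V → V → Prop) (I : Set V) : Prop :=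
  G.IsMaxIndep I ∧ ∀ J : Set V, G.IsMaxIndep J → J ≠ I →
    ∃ v ∈ I, v ∉ J ∧ ∀ w, lt w v → (w ∈ I ↔ w ∈ J)

/-- The lexicographically first maximal independent set of `G` for the vertex order `lt`. -/
def DGraph.lfmis {V : Type} (G : DGraph V) (lt : V → V → Prop) : Set V :=
  {v | ∃ I, G.IsLFMIS lt I ∧ v ∈ I}

/-! ### Factored graphs -/

/-- An input graph, on the vertices `0, …, size - 1`. -/
structure InputGraph where
  size : ℕ
  Edge : Fin size → Fin size → Prop

/-- An input graph as a graph on one-element tuples. -/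
def InputGraph.toDGraph (A : InputGraph) : DGraph (List ℕ) where
  verts := {w | ∃ i : Fin A.size, w = [(i : ℕ)]}
  Edge w w' := ∃ i j : Fin A.size, w = [(i : ℕ)] ∧ w' = [(j : ℕ)] ∧ A.Edge i j
  edge_mem := by
    rintro w w' ⟨i, j, h, h', -⟩
    exact ⟨⟨i, h⟩, ⟨j, h'⟩⟩

/-- Factored graph formulas: expressions over input graphs with three binary operations. -/
inductive Formula where
  | input (A : InputGraph) : Formula
  | cart (f g : Formula) : Formula
  | tensor (f g : Formula) : Formula
  | union (f g : Formula) : Formula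

/-- The factored graph of a formula; its vertices are flattened tuples, to be ordered
lexicographically. -/
def Formula.eval : Formula → DGraph (List ℕ)
  | .input A => A.toDGraph
  | .cart f g => f.eval.cart g.eval
  | .tensor f g => f.eval.tensor g.eval
  | .union f g => f.eval.union g.eval

/-- The number of operations in a formula. -/
def Formula.ops : Formula → ℕ
  | .input _ => 0
  | .cart f g => f.ops + g.ops + 1
  | .tensor f g => f.ops + g.ops + 1
  | .union f g => f.ops + g.ops + 1

/-- All the input graphs of a formula have at most `n` vertices. -/
def Formula.InputsLE (n : ℕ) : Formula → Prop
  | .input A => A.size ≤ n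
  | .cart f g => f.InputsLE n ∧ g.InputsLE n
  | .tensor f g => f.InputsLE n ∧ g.InputsLE n
  | .union f g => f.InputsLE n ∧ g.InputsLE n

/-- Complexity `(n, k)`: `k - 1` operations on input graphs of size at most `n`. -/
def Formula.HasComplexity (f : Formula) (n k : ℕ) : Prop :=
  f.InputsLE n ∧ f.ops + 1 = k

/-! ### Deterministic single-tape Turing machines -/

inductive Dir where
  | L : Dir
  | R : Dir

/-- A deterministic single-tape Turing machine with state set `Q`, tape alphabet `Γ` and input
alphabet `α`, which `inp` embeds into `Γ` without the blank symbol. The values of `δ` at the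
halting states are never used. -/
structure TM (α Q Γ : Type) where
  δ : Q → Γ → Q × Γ × Dir
  q₀ : Q
  qacc : Q
  qrej : Q
  qacc_ne_qrej : qacc ≠ qrej
  blank : Γ
  inp : α ↪ Γ
  inp_ne_blank : ∀ a, inp a ≠ blank

/-- A configuration. The tape is infinite to the right; its leftmost cell has number `0`. -/
structure Cfg (Q Γ : Type) where
  state : Q
  head : ℕ
  tape : ℕ → Γ

namespace TM

variable {α Q Γ : Type} (M : TM α Q Γ)

def Halting (q : Q) : Prop := q = M.qacc ∨ q = M.qrej

def init (x : List α) : Cfg Q Γ where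
  state := M.q₀
  head := 0
  tape i := (x[i]?).elim M.blank M.inp

open Classical in
/-- One step. There is no next configuration in a halting state, nor after a left move in the
leftmost cell: a machine that falls off its tape stops without having halted. -/
noncomputable def step (c : Cfg Q Γ) : Option (Cfg Q Γ) :=
  if M.Halting c.state then none
  else
    match M.δ c.state (c.tape c.head), c.head with
    | (q, a, Dir.R), h => some ⟨q, h + 1, Function.update c.tape h a⟩
    | (_, _, Dir.L), 0 => none
    | (q, a, Dir.L), h + 1 => some ⟨q, h, Function.update c.tape (h + 1) a⟩

/-- The configuration after `s` steps on input `x`, if the machine makes that many. -/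
noncomputable def run (x : List α) : ℕ → Option (Cfg Q Γ)
  | 0 => some (M.init x)
  | s + 1 => (run x s).bind M.step

/-- On input `x` the machine enters a halting state after exactly `s` steps. -/
def HaltsAfter (x : List α) (s : ℕ) : Prop :=
  ∃ c, M.run x s = some c ∧ M.Halting c.state

def Accepts (x : List α) : Prop :=
  ∃ s c, M.run x s = some c ∧ c.state = M.qacc

/-- Whenever the machine halts, the head is on the leftmost cell and that cell is blank. -/
def Normalized : Prop :=
  ∀ x s c, M.run x s = some c → M.Halting c.state → c.head = 0 ∧ c.tape 0 = M.blank

/-- `M` decides `L` in time `O(n ^ ℓ)`. -/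
def DecidesInTimePow (L : Language α) (ℓ : ℕ) : Prop :=
  (∀ x, x ∈ L ↔ M.Accepts x) ∧
    ∃ f : ℕ → ℕ, (∀ x : List α, ∃ s ≤ f x.length, M.HaltsAfter x s) ∧
      (fun n : ℕ => (f n : ℝ)) =O[atTop] (fun n : ℕ => (n : ℝ) ^ ℓ)

end TM

/-! ### The tiles: pairs of an extended state and an extended symbol -/

/-- `Q ∪ {*, q̇₀}`: `start` is the special start state `q̇₀`, and `star` is `*`, which says that
the head is elsewhere. -/
inductive XState (Q : Type) where
  | start : XState Q
  | star : XState Q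
  | st (q : Q) : XState Q

/-- `Γ ∪ {ẋ₁, …, ẋₙ}`: `special i` is the special input symbol `ẋᵢ₊₁`, with distinct symbols
for distinct positions. -/
inductive XSym (Γ : Type) (n : ℕ) where
  | special (i : Fin n) : XSym Γ n
  | sym (a : Γ) : XSym Γ n

abbrev Tile (Q Γ : Type) (n : ℕ) : Type := XState Q × XSym Γ n

/-- `Q ∪ {*}` inside `Q ∪ {*, q̇₀}`. -/
def plainStates (Q : Type) : Set (XState Q) := {p | p ≠ XState.start}

/-- `Γ` inside `Γ ∪ {ẋ₁, …, ẋₙ}`. -/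
def plainSyms (Γ : Type) (n : ℕ) : Set (XSym Γ n) := Set.range XSym.sym

/-- The four neighbouring directions of the grid. -/
inductive GDir where
  | V : GDir
  | H : GDir
  | R : GDir
  | L : GDir

namespace TM

variable {α Q Γ : Type} (M : TM α Q Γ) (x : List α)

/-- Replace `q̇₀` by `q₀`; `none` stands for `*`. -/
def unstar : XState Q → Option Q
  | .start => some M.q₀
  | .star => none
  | .st q => some q

/-- Replace `ẋᵢ` by `xᵢ`. -/
def undot : XSym Γ x.length → Γ
  | .special i => M.inp (x.get i)
  | .sym a => a

open Classical in
/-- Vertical consistency. -/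
noncomputable def consV (t : Tile Q Γ x.length) : Set (Tile Q Γ x.length) :=
  match M.unstar t.1 with
  | none => plainStates Q ×ˢ {XSym.sym (M.undot x t.2)}
  | some q =>
    if M.Halting q then {(XState.st q, XSym.sym (M.undot x t.2))}
    else {(XState.star, XSym.sym (M.δ q (M.undot x t.2)).2.1)}

/-- Horizontal consistency. -/
def consH (t : Tile Q Γ x.length) : Set (Tile Q Γ x.length) :=
  match t.2 with
  | .special i => plainStates Q ×ˢ
      (plainSyms Γ x.length ∪ {a | ∃ j : Fin x.length, (j : ℕ) = i + 1 ∧ a = XSym.special j})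
  | .sym _ => plainStates Q ×ˢ plainSyms Γ x.length

open Classical in
/-- Diagonal consistency towards the side `d`: if the head is on the tile and moves to the side
`d`, it carries the new state there; if it moves to the other side, no head arrives. -/
noncomputable def consDiag (d : Dir) (t : Tile Q Γ x.length) : Set (Tile Q Γ x.length) :=
  match M.unstar t.1 with
  | none => plainStates Q ×ˢ plainSyms Γ x.length
  | some q =>
    if M.Halting q then plainStates Q ×ˢ plainSyms Γ x.length
    else if (M.δ q (M.undot x t.2)).2.2 = d then
      {XState.st (M.δ q (M.undot x t.2)).1} ×ˢ plainSyms Γ x.length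
    else {XState.star} ×ˢ plainSyms Γ x.length

/-- `M.cons x D t` is the set of tiles that are consistent with `t` when placed next to `t` in
the direction `D`. -/
noncomputable def cons : GDir → Tile Q Γ x.length → Set (Tile Q Γ x.length)
  | .V => M.consV x
  | .H => consH x
  | .R => M.consDiag x Dir.R
  | .L => M.consDiag x Dir.L

end TM

/-! ### The grid of supernodes -/

/-- The vertex `(row, col, q, a)`, which lies in the supernode `S (row, col)`. -/
structure Node (Q Γ : Type) (n : ℕ) where
  row : ℕ
  col : ℕ
  tile : Tile Q Γ n

/-- The supernode `S (i, j)` is the parent of `S (i', j')` in the given direction. -/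
def IsParent : GDir → ℕ × ℕ → ℕ × ℕ → Prop
  | .V, (i, j), (i', j') => i' = i + 1 ∧ j' = j
  | .H, (i, j), (i', j') => i' = i ∧ j' = j + 1
  | .R, (i, j), (i', j') => i' = i + 1 ∧ j' = j + 1
  | .L, (i, j), (i', j') => i' = i + 1 ∧ j' + 1 = j

/-- The vertices of the `T × T` grid of supernodes; rows and columns run from `1` to `T`. -/
def gridVerts (Q Γ : Type) (n T : ℕ) : Set (Node Q Γ n) :=
  {v | 1 ≤ v.row ∧ v.row ≤ T ∧ 1 ≤ v.col ∧ v.col ≤ T}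

/-- The graph that simulates `M` on `x` for `T` time steps: every supernode is a complete graph,
and there is an edge from a vertex of a parent supernode to a vertex of its child in the
direction `D` exactly if their tiles are not consistent. -/
def TM.gridGraph {α Q Γ : Type} (M : TM α Q Γ) (x : List α) (T : ℕ) :
    DGraph (Node Q Γ x.length) where
  verts := gridVerts Q Γ x.length T
  Edge u v := u ∈ gridVerts Q Γ x.length T ∧ v ∈ gridVerts Q Γ x.length T ∧
    ((u.row = v.row ∧ u.col = v.col ∧ u ≠ v) ∨
      ∃ D : GDir, IsParent D (u.row, u.col) (v.row, v.col) ∧ v.tile ∉ M.cons x D u.tile)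
  edge_mem := fun h => ⟨h.1, h.2.1⟩

/-- The vertex `(T, 1, q_accept, blank)`. -/
def TM.acceptNode {α Q Γ : Type} (M : TM α Q Γ) (n T : ℕ) : Node Q Γ n :=
  ⟨T, 1, (XState.st M.qacc, XSym.sym M.blank)⟩

/-- An enumeration of the states, and one of the tape symbols that starts with the blank. -/
structure TM.Numbering {α Q Γ : Type} [Fintype Q] [Fintype Γ] (M : TM α Q Γ) where
  stateIdx : Q ≃ Fin (Fintype.card Q)
  symIdx : Γ ≃ Fin (Fintype.card Γ)
  symIdx_blank : (symIdx M.blank : ℕ) = 0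

namespace TM.Numbering

variable {α Q Γ : Type} [Fintype Q] [Fintype Γ] {M : TM α Q Γ} (ν : M.Numbering)

/-- The index of an extended state: first `q̇₀`, then `*`, then `Q`. -/
def xstateIdx : XState Q → ℕ
  | .start => 0
  | .star => 1
  | .st q => ν.stateIdx q + 2

/-- The index of an extended symbol: first `ẋ₁, …, ẋₙ`, then the blank, then the rest. -/
def xsymIdx {n : ℕ} : XSym Γ n → ℕ
  | .special i => i
  | .sym a => n + ν.symIdx a

/-- The number of tiles. -/
def tileCount (_ : M.Numbering) (n : ℕ) : ℕ := (Fintype.card Q + 2) * (Fintype.card Γ + n)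

/-- The index of a tile in the lexicographic order on pairs. -/
def tileIdx {n : ℕ} (t : Tile Q Γ n) : ℕ :=
  ν.xstateIdx t.1 * (Fintype.card Γ + n) + ν.xsymIdx t.2

/-- The lexicographic order on the vertices `(i, j, q, a)` of the grid. -/
def prec {n : ℕ} (u v : Node Q Γ n) : Prop :=
  toLex (u.row, toLex (u.col, toLex (ν.xstateIdx u.tile.1, ν.xsymIdx u.tile.2))) <
    toLex (v.row, toLex (v.col, toLex (ν.xstateIdx v.tile.1, ν.xsymIdx v.tile.2)))

end TM.Numbering

/-! ### The factored representation of the grid -/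

/-- The `k` base-`b` digits of `m`, the most significant digit first. -/
def digits (b k m : ℕ) : List ℕ := (List.range k).reverse.map fun i => m / b ^ i % b

/-- The empty graph on `b` vertices. -/
def emptyInput (b : ℕ) : InputGraph := ⟨b, fun _ _ => False⟩

/-- The complete graph on `b` vertices. -/
def completeInput (b : ℕ) : InputGraph := ⟨b, fun i j => i ≠ j⟩

/-- The edges `i → i + 1`. -/
def succInput (b : ℕ) : InputGraph := ⟨b, fun i j => (j : ℕ) = i + 1⟩

/-- The single edge `b - 1 → 0`. -/
def wrapInput (b : ℕ) : InputGraph := ⟨b, fun i j => (i : ℕ) + 1 = b ∧ (j : ℕ) = 0⟩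

def InputGraph.reverse (A : InputGraph) : InputGraph := ⟨A.size, fun i j => A.Edge j i⟩

namespace Formula

/-- `A □ ⋯ □ A □ f`, with `m` factors `A`. -/
def cartPrefix (A : InputGraph) : ℕ → Formula → Formula
  | 0, f => f
  | m + 1, f => .cart (.input A) (cartPrefix A m f)

/-- `f × C × ⋯ × C`, with `m` factors `C`. -/
def tensorSuffix (C : InputGraph) : ℕ → Formula → Formula
  | 0, f => f
  | m + 1, f => .tensor (tensorSuffix C m f) (.input C)

/-- `f 0 ∪ ⋯ ∪ f m`. -/
def unionUpTo (f : ℕ → Formula) : ℕ → Formula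
  | 0 => f 0
  | m + 1 => .union (unionUpTo f m) (f (m + 1))

/-- The empty graph on `b ^ k` vertices, as a Cartesian power (for `k ≥ 1`). -/
def emptyPow (b k : ℕ) : Formula :=
  cartPrefix (emptyInput b) (k - 1) (.input (emptyInput b))

/-- The union over `i < k` of `A □ ⋯ □ A □ (B × C × ⋯ × C)`, with `k - i - 1` factors `A` and
`i` factors `C`, where `A` is the empty graph on `b` vertices (for `k ≥ 1`). -/
def pathOf (b k : ℕ) (B C : InputGraph) : Formula :=
  unionUpTo (fun i => cartPrefix (emptyInput b) (k - i - 1) (tensorSuffix C i (.input B))) (k - 1)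

/-- The increasing path on the `b ^ k` numbers with `k` digits in base `b`. -/
def incPath (b k : ℕ) : Formula := pathOf b k (succInput b) (wrapInput b)

/-- The decreasing path on the `b ^ k` numbers with `k` digits in base `b`. -/
def decPath (b k : ℕ) : Formula := pathOf b k (succInput b).reverse (wrapInput b).reverse

/-- The grid of `b ^ k × b ^ k` points with an edge from each point to its neighbour in the given
direction. -/
def grid (b k : ℕ) : GDir → Formula
  | .V => .cart (incPath b k) (emptyPow b k)
  | .H => .cart (emptyPow b k) (incPath b k)
  | .R => .tensor (incPath b k) (incPath b k)
  | .L => .tensor (incPath b k) (decPath b k)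

end Formula

namespace TM.Numbering

variable {α Q Γ : Type} [Fintype Q] [Fintype Γ] {M : TM α Q Γ} (ν : M.Numbering) (x : List α)

/-- The consistency relation graph: an edge from `t` to `t'` if `t'` is not consistent with `t`
in the direction `D`. -/
def relInput (D : GDir) : InputGraph where
  size := ν.tileCount x.length
  Edge i j := ∃ t t' : Tile Q Γ x.length,
    ν.tileIdx t = i ∧ ν.tileIdx t' = j ∧ t' ∉ M.cons x D t

/-- The grid in the direction `D`, with every point blown up to a supernode. -/
def superGrid (b k : ℕ) (D : GDir) : Formula :=
  .tensor (.grid b k D) (.input (ν.relInput x D))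

/-- The factored representation of the graph that simulates `M` on `x` for `b ^ k` time steps. -/
def factored (b k : ℕ) : Formula :=
  .union
    (.cart (.cart (.emptyPow b k) (.emptyPow b k)) (.input (completeInput (ν.tileCount x.length))))
    (.union (.union (.union (ν.superGrid x b k .V) (ν.superGrid x b k .H))
      (ν.superGrid x b k .R)) (ν.superGrid x b k .L))

/-- The vertex `(i, j, q, a)` as a flattened tuple: the digits of `i - 1`, the digits of `j - 1`
and the index of the tile `(q, a)`. -/
def code {n : ℕ} (b k : ℕ) (v : Node Q Γ n) : List ℕ :=
  digits b k (v.row - 1) ++ digits b k (v.col - 1) ++ [ν.tileIdx v.tile]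

end TM.Numbering

end FactoredLFMIS

/-! For a well-founded total vertex order, the LFMIS is the outcome of the greedy algorithm
(`DGraph.IsGreedy.lfmis_eq`), so it is enough to exhibit one set with the greedy property. In the
grid graph this set is the space-time diagram of the run, with one tile per supernode and the
halting configuration repeated forever (`isGreedy_diagram`). Tiles of the diagram are consistent
with their parents (`tileAt_mem_cons`), so it contains no edge. A tile after the correct one in its
supernode is blocked by the clique. A tile before the correct one is inconsistent with the correct
tile of some parent (`exists_not_mem_cons`).

This last point explains the order on symbols. In the first row the least choices spell the start
state, the input and then blanks, as horizontal consistency forbids a second start state or an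
out-of-place input symbol. Below it, vertical consistency fixes the symbol, and the least state left
is `*`, unless the head arrives; then the diagonal parent that held the head forces the new state.
For a normalized machine the answer stands in the first cell of the last row.

The factored form rests on the odometer: adding one in base `b` turns `p d (b-1)...(b-1)` into `p
(d+1) 0...0` (`succ_digits_iff`). A Cartesian product with an edgeless graph keeps `p` fixed, while
tensor products with `B` and the copies of `C` change the other digits at once. All tuples have
fixed length, so flattening loses nothing and lexicographic order is numerical order. The resulting
ordered isomorphism transports the greedy set, hence the LFMIS.

For the time bound, the least sufficient power of `b` has an exponent linear in `ℓ`. The normal form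
is reached by marking the leftmost cell, simulating, walking back to the mark and erasing it. -/

namespace FactoredLFMIS

/-! ### Greedy independent sets -/

/-- `I` is the outcome of the greedy algorithm: a vertex belongs to `I` exactly if it is not
adjacent to an earlier member of `I`. -/
def DGraph.IsGreedy {V : Type} (G : DGraph V) (lt : V → V → Prop) (I : Set V) : Prop :=
  ∀ v, v ∈ I ↔ v ∈ G.verts ∧ ∀ u ∈ I, lt u v → ¬ G.Edge u v ∧ ¬ G.Edge v u

/-- At the first vertex where `I` and a maximal independent `J` differ, all earlier members of `I`
lie in `J`. If the vertex were in `J`, none of them would be adjacent to it, so greediness would put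
it in `I` as well. -/
theorem DGraph.IsGreedy.isLFMIS {V : Type} {G : DGraph V} {lt : V → V → Prop} {I : Set V}
    (hI : G.IsGreedy lt I) (hwf : G.verts.WellFoundedOn lt)
    (htri : ∀ u ∈ G.verts, ∀ v ∈ G.verts, lt u v ∨ u = v ∨ lt v u) : G.IsLFMIS lt I := by
  have hsub : I ⊆ G.verts := fun v hv => ((hI v).1 hv).1
  have hind : G.IsIndep I := by
    refine ⟨hsub, fun u hu v hv huv => ?_⟩
    rcases htri u (hsub hu) v (hsub hv) with h | h | h
    · exact (((hI v).1 hv).2 u hu h).1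
    · exact absurd h huv
    · exact (((hI u).1 hu).2 v hv h).2
  refine ⟨⟨hind, fun J hIJ hJ => ?_⟩, fun J hJ hne => ?_⟩
  · obtain ⟨v, hvJ, hvI⟩ := Set.exists_of_ssubset hIJ
    refine hvI ((hI v).2 ⟨hJ.1 hvJ, fun u hu _ => ?_⟩)
    have huv : u ≠ v := fun h => hvI (h ▸ hu)
    exact ⟨hJ.2 u (hIJ.1 hu) v hvJ huv, hJ.2 v hvJ u (hIJ.1 hu) huv.symm⟩
  · have hdiff : ∃ v : G.verts, ¬ ((v : V) ∈ I ↔ (v : V) ∈ J) := by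
      by_contra! h
      refine hne (Set.ext fun v => ?_)
      by_cases hv : v ∈ G.verts
      · exact (h ⟨v, hv⟩).symm
      · exact ⟨fun h' => absurd (hJ.1.1 h') hv, fun h' => absurd (hsub h') hv⟩
    obtain ⟨⟨v, hv⟩, hvd, hmin⟩ := WellFounded.has_min hwf
      {v : G.verts | ¬ ((v : V) ∈ I ↔ (v : V) ∈ J)} hdiff
    have hagree : ∀ w, lt w v → (w ∈ I ↔ w ∈ J) := by
      intro w hw
      by_cases hwv : w ∈ G.verts
      · by_contra h
        exact hmin ⟨w, hwv⟩ h hw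
      · exact ⟨fun h' => absurd (hsub h') hwv, fun h' => absurd (hJ.1.1 h') hwv⟩
    have hvI : v ∈ I := by
      by_contra hvI
      have hvJ : v ∈ J := by
        by_contra hvJ
        exact hvd ⟨fun h => absurd h hvI, fun h => absurd h hvJ⟩
      refine hvI ((hI v).2 ⟨hv, fun u hu huv => ?_⟩)
      have huJ := (hagree u huv).1 hu
      have hne' : u ≠ v := fun h => hvI (h ▸ hu)
      exact ⟨hJ.1.2 u huJ v hvJ hne', hJ.1.2 v hvJ u huJ hne'.symm⟩
    exact ⟨v, hvI, fun hvJ => hvd ⟨fun _ => hvJ, fun _ => hvI⟩, hagree⟩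

/-- Two distinct such sets would each own a first difference; the earlier of the two witnesses
contradicts the agreement below the other. -/
theorem DGraph.IsLFMIS.lfmis_eq {V : Type} {G : DGraph V} {lt : V → V → Prop} {I : Set V}
    (hI : G.IsLFMIS lt I) (htri : ∀ u ∈ G.verts, ∀ v ∈ G.verts, lt u v ∨ u = v ∨ lt v u) :
    G.lfmis lt = I := by
  ext w
  refine ⟨fun ⟨J, hJ, hw⟩ => ?_, fun hw => ⟨I, hI, hw⟩⟩
  by_cases hne : J = I
  · exact hne ▸ hw
  · exfalso
    obtain ⟨v, hvI, hvJ, hv⟩ := hI.2 J hJ.1 hne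
    obtain ⟨u, huJ, huI, hu⟩ := hJ.2 I hI.1 (Ne.symm hne)
    rcases htri u (hJ.1.1.1 huJ) v (hI.1.1.1 hvI) with h | h | h
    · exact huI ((hv u h).2 huJ)
    · exact huI (h ▸ hvI)
    · exact hvJ ((hu v h).2 hvI)

theorem DGraph.IsGreedy.lfmis_eq {V : Type} {G : DGraph V} {lt : V → V → Prop} {I : Set V}
    (hI : G.IsGreedy lt I) (hwf : G.verts.WellFoundedOn lt)
    (htri : ∀ u ∈ G.verts, ∀ v ∈ G.verts, lt u v ∨ u = v ∨ lt v u) : G.lfmis lt = I :=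
  (hI.isLFMIS hwf htri).lfmis_eq htri

theorem DGraph.IsOrderedIso.isGreedy_image {V W : Type} {G : DGraph V} {lt : V → V → Prop}
    {H : DGraph W} {lt' : W → W → Prop} {φ : V → W} (h : G.IsOrderedIso lt H lt' φ)
    {I : Set V} (hI : G.IsGreedy lt I) : H.IsGreedy lt' (φ '' I) := by
  have hsub : I ⊆ G.verts := fun v hv => ((hI v).1 hv).1
  intro w
  constructor
  · rintro ⟨v, hv, rfl⟩
    refine ⟨h.1.mapsTo (hsub hv), ?_⟩
    rintro _ ⟨u, hu, rfl⟩ huv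
    have := ((hI v).1 hv).2 u hu ((h.2 u (hsub hu) v (hsub hv)).2.2 huv)
    rwa [(h.2 u (hsub hu) v (hsub hv)).1, (h.2 v (hsub hv) u (hsub hu)).1] at this
  · rintro ⟨hw, hw'⟩
    obtain ⟨v, hv, rfl⟩ := h.1.surjOn hw
    refine ⟨v, (hI v).2 ⟨hv, fun u hu huv => ?_⟩, rfl⟩
    rw [(h.2 u (hsub hu) v hv).1, (h.2 v hv u (hsub hu)).1]
    exact hw' _ ⟨u, hu, rfl⟩ ((h.2 u (hsub hu) v hv).2.1 huv)

/-! ### Runs of Turing machines -/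

namespace TM

variable {α Q Γ : Type} {M : TM α Q Γ} {x : List α}

theorem step_of_halting {c : Cfg Q Γ} (h : M.Halting c.state) : M.step c = none := by
  simp [step, h]

theorem run_add_of_halting {s : ℕ} {c : Cfg Q Γ} (hc : M.run x s = some c)
    (h : M.Halting c.state) (d : ℕ) : M.run x (s + d + 1) = none := by
  induction d with
  | zero => simp [run, hc, step_of_halting h]
  | succ d ih => rw [← add_assoc, run, ih]; rfl

/-- A halting configuration has no successor, so no run passes through two of them. This makes
acceptance readable from any known halting configuration. -/
theorem halting_unique {s s' : ℕ} {c c' : Cfg Q Γ} (hc : M.run x s = some c)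
    (h : M.Halting c.state) (hc' : M.run x s' = some c') (h' : M.Halting c'.state) : c = c' := by
  rcases lt_trichotomy s s' with hs | rfl | hs
  · obtain ⟨d, rfl⟩ := Nat.exists_eq_add_of_lt hs
    simp [run_add_of_halting hc h d] at hc'
  · simpa [hc] using hc'
  · obtain ⟨d, rfl⟩ := Nat.exists_eq_add_of_lt hs
    simp [run_add_of_halting hc' h' d] at hc

theorem accepts_iff_of_halting {s : ℕ} {c : Cfg Q Γ} (hc : M.run x s = some c)
    (h : M.Halting c.state) : M.Accepts x ↔ c.state = M.qacc := by
  refine ⟨fun ⟨s', c', hc', h'⟩ => ?_, fun h' => ⟨s, c, hc, h'⟩⟩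
  rw [halting_unique hc h hc' (Or.inl h'), h']

theorem exists_run_of_le {s : ℕ} {c : Cfg Q Γ} (hc : M.run x s = some c) {i : ℕ} (hi : i ≤ s) :
    ∃ c', M.run x i = some c' := by
  induction s generalizing c with
  | zero => obtain rfl : i = 0 := by omega
            exact ⟨c, hc⟩
  | succ s ih =>
    rcases Nat.lt_or_ge i (s + 1) with h | h
    · cases hs : M.run x s with
      | none => simp [run, hs] at hc
      | some c' => exact ih hs (by omega)
    · obtain rfl : i = s + 1 := by omega
      exact ⟨c, hc⟩

/-- The possible outcomes of a step. -/
theorem step_eq_some {c c' : Cfg Q Γ} (h : M.step c = some c') :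
    ¬ M.Halting c.state ∧ c'.state = (M.δ c.state (c.tape c.head)).1 ∧
      c'.tape = Function.update c.tape c.head (M.δ c.state (c.tape c.head)).2.1 ∧
      (((M.δ c.state (c.tape c.head)).2.2 = Dir.R ∧ c'.head = c.head + 1) ∨
        ((M.δ c.state (c.tape c.head)).2.2 = Dir.L ∧ c'.head + 1 = c.head)) := by
  unfold step at h
  split_ifs at h with hh
  refine ⟨hh, ?_⟩
  split at h <;> simp_all
  all_goals subst h; simp

theorem step_eq_some_of {c c' : Cfg Q Γ} {q : Q} {a : Γ} {d : Dir} (hh : ¬ M.Halting c.state)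
    (hδ : M.δ c.state (c.tape c.head) = (q, a, d)) (hq : c'.state = q)
    (ht : c'.tape = Function.update c.tape c.head a)
    (hd : (d = Dir.R ∧ c'.head = c.head + 1) ∨ (d = Dir.L ∧ c'.head + 1 = c.head)) :
    M.step c = some c' := by
  obtain ⟨p, h, t⟩ := c
  obtain ⟨p', h', t'⟩ := c'
  simp only at hh hδ hq ht hd
  rcases hd with ⟨rfl, rfl⟩ | ⟨rfl, rfl⟩ <;> simp [step, hh, hδ, hq, ht]

theorem head_le_of_run {s : ℕ} {c : Cfg Q Γ} (hc : M.run x s = some c) : c.head ≤ s := by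
  induction s generalizing c with
  | zero => simp only [run, Option.some.injEq] at hc; simp [← hc, init]
  | succ s ih =>
    cases hs : M.run x s with
    | none => simp [run, hs] at hc
    | some c' =>
      simp only [run, hs, Option.bind_some] at hc
      have := ih hs
      obtain ⟨-, -, -, h | h⟩ := step_eq_some hc <;> omega

end TM

namespace TM

variable {α Q Γ : Type} {M : TM α Q Γ} {x : List α}

/-! ### Simulation of a machine by the grid graph -/

/-- The sequence of configurations on input `x`, continued forever from a halting one. -/
def IsFrozenRun (M : TM α Q Γ) (x : List α) (c : ℕ → Cfg Q Γ) : Prop :=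
  c 0 = M.init x ∧
    ∀ i, (M.Halting (c i).state ∧ c (i + 1) = c i) ∨ M.step (c i) = some (c (i + 1))

/-- Stopping the clock at `s`, that is, taking the configuration at time `min i s`, gives a sequence
defined for every row of the grid. -/
theorem exists_isFrozenRun {s : ℕ} {cs : Cfg Q Γ} (hs : M.run x s = some cs)
    (hcs : M.Halting cs.state) : ∃ c, M.IsFrozenRun x c ∧ ∀ i, s ≤ i → c i = cs := by
  have hex : ∀ i, ∃ c', M.run x (min i s) = some c' := fun i =>
    exists_run_of_le hs (min_le_right i s)
  choose c hc using hex
  have hfin : ∀ i, s ≤ i → c i = cs := fun i hi => by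
    have := hc i
    rw [min_eq_right hi, hs] at this
    exact (Option.some.inj this).symm
  refine ⟨c, ⟨?_, fun i => ?_⟩, hfin⟩
  · have := hc 0
    rw [Nat.zero_min, run] at this
    exact (Option.some.inj this).symm
  · rcases Nat.lt_or_ge i s with h | h
    · right
      have h1 := hc i
      have h2 := hc (i + 1)
      rw [min_eq_left h.le] at h1
      rw [min_eq_left h, run, h1] at h2
      exact h2
    · left
      rw [hfin i h, hfin (i + 1) (by omega)]
      exact ⟨hcs, rfl⟩

/-- The head moves at most one cell per step; hence a supernode that holds the head in a row of the
grid also has its column in the grid. -/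
theorem IsFrozenRun.head_le {c : ℕ → Cfg Q Γ} (hc : M.IsFrozenRun x c) (i : ℕ) :
    (c i).head ≤ i := by
  induction i with
  | zero => simp [hc.1, init]
  | succ i ih =>
    rcases hc.2 i with ⟨-, h⟩ | h
    · rw [h]; omega
    · obtain ⟨-, -, -, h | h⟩ := step_eq_some h <;> omega

open Classical in
/-- The tile at row `i` and column `j`, counted from `0`, of the space-time diagram of `c`. -/
noncomputable def tileAt (x : List α) (M : TM α Q Γ) (c : ℕ → Cfg Q Γ) (i j : ℕ) :
    Tile Q Γ x.length :=
  if i = 0 then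
    (if j = 0 then .start else .star,
      if h : j < x.length then .special ⟨j, h⟩ else .sym M.blank)
  else
    (if (c i).head = j then .st (c i).state else .star, .sym ((c i).tape j))

theorem tileAt_succ (c : ℕ → Cfg Q Γ) (i j : ℕ) : tileAt x M c (i + 1) j =
    (if (c (i + 1)).head = j then .st (c (i + 1)).state else .star, .sym ((c (i + 1)).tape j)) := by
  simp [tileAt]

theorem unstar_tileAt {c : ℕ → Cfg Q Γ} (hc : M.IsFrozenRun x c) (i j : ℕ) :
    M.unstar (tileAt x M c i j).1 = if (c i).head = j then some (c i).state else none := by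
  rcases i with _ | i
  · by_cases h : j = 0
    · simp [tileAt, hc.1, init, h, unstar]
    · simp [tileAt, hc.1, init, h, unstar, Ne.symm h]
  · rw [tileAt_succ]
    split_ifs <;> simp [unstar]

theorem undot_tileAt {c : ℕ → Cfg Q Γ} (hc : M.IsFrozenRun x c) (i j : ℕ) :
    M.undot x (tileAt x M c i j).2 = (c i).tape j := by
  rcases i with _ | i
  · by_cases h : j < x.length
    · simp [tileAt, hc.1, init, h, undot]
    · simp [tileAt, hc.1, init, h, undot]
  · simp [tileAt_succ, undot]

theorem tileAt_succ_mem_plain (c : ℕ → Cfg Q Γ) (i j : ℕ) :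
    (tileAt x M c (i + 1) j).1 ∈ plainStates Q ∧
      (tileAt x M c (i + 1) j).2 ∈ plainSyms Γ x.length := by
  rw [tileAt_succ]
  refine ⟨?_, _, rfl⟩
  simp only [plainStates, Set.mem_ofPred_eq]
  split_ifs <;> simp

/-- Under the head everything below is determined: a halted head stays, and a running head leaves,
since no move is stationary. Elsewhere only the symbol is determined. -/
theorem consV_tileAt {c : ℕ → Cfg Q Γ} (hc : M.IsFrozenRun x c) (i j : ℕ) :
    M.consV x (tileAt x M c i j) =
      if (c i).head = j then {tileAt x M c (i + 1) j}
      else plainStates Q ×ˢ {XSym.sym ((c (i + 1)).tape j)} := by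
  classical
  unfold consV
  rw [unstar_tileAt hc, undot_tileAt hc, tileAt_succ]
  by_cases hj : (c i).head = j
  · simp only [hj, if_true]
    rcases hc.2 i with ⟨hh, h⟩ | h
    · simp [hh, h, hj]
    · obtain ⟨hh, h1, h2, h3⟩ := step_eq_some h
      have hne : (c (i + 1)).head ≠ j := by omega
      rw [if_neg hh, if_neg hne, h2, ← hj, Function.update_self]
  · simp only [hj, if_false]
    rcases hc.2 i with ⟨hh, h⟩ | h
    · rw [h]
    · obtain ⟨hh, h1, h2, h3⟩ := step_eq_some h
      rw [h2, Function.update_of_ne (Ne.symm hj)]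

open Classical in
theorem consDiag_tileAt {c : ℕ → Cfg Q Γ} (hc : M.IsFrozenRun x c) (d : Dir) (i j : ℕ) :
    M.consDiag x d (tileAt x M c i j) =
      if (c i).head = j ∧ ¬ M.Halting (c i).state then
        (if (M.δ (c i).state ((c i).tape j)).2.2 = d then {XState.st (c (i + 1)).state}
          else {XState.star}) ×ˢ plainSyms Γ x.length
      else plainStates Q ×ˢ plainSyms Γ x.length := by
  classical
  unfold consDiag
  rw [unstar_tileAt hc, undot_tileAt hc]
  by_cases hj : (c i).head = j
  · simp only [hj, if_true, true_and]
    rcases hc.2 i with ⟨hh, h⟩ | h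
    · simp [hh]
    · obtain ⟨hh, h1, h2, h3⟩ := step_eq_some h
      rw [h1, hj]
      simp only [hh, if_false, not_false_eq_true, if_true]
      split_ifs <;> rfl
  · simp [hj]

theorem consH_fst {t t' : Tile Q Γ x.length} (h : t' ∈ consH x t) : t'.1 ∈ plainStates Q := by
  unfold consH at h
  split at h <;> exact h.1

/-- A tile of the space-time diagram is consistent with its parents. -/
theorem tileAt_mem_cons {c : ℕ → Cfg Q Γ} (hc : M.IsFrozenRun x c) (D : GDir) {i j i' j' : ℕ}
    (h : IsParent D (i, j) (i', j')) : tileAt x M c i' j' ∈ M.cons x D (tileAt x M c i j) := by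
  have hpl := tileAt_succ_mem_plain (x := x) (M := M) c
  cases D with
  | V =>
    obtain ⟨rfl, rfl⟩ := h
    rw [cons, consV_tileAt hc]
    split_ifs
    · rfl
    · exact ⟨(hpl i j').1, by simp [tileAt_succ]⟩
  | H =>
    obtain ⟨rfl, rfl⟩ := h
    rw [cons]
    rcases i' with _ | i
    · by_cases hj : j < x.length
      · simp only [tileAt, hj, consH, dite_true, if_true]
        refine ⟨by simp [plainStates], ?_⟩
        -- At the last input position there is no next special symbol, and the row continues with a
        -- blank.
        by_cases hj' : j + 1 < x.length
        · right
          simp only [hj', dite_true]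
          exact ⟨_, rfl, rfl⟩
        · left
          simp [hj', plainSyms]
      · have hj' : ¬ j + 1 < x.length := by omega
        simp [tileAt, hj, hj', consH, plainStates, plainSyms]
    · have h1 := hpl i (j + 1)
      rw [tileAt_succ c i j]
      exact h1
  | R =>
    obtain ⟨rfl, rfl⟩ := h
    rw [cons, consDiag_tileAt hc]
    have h1 := hpl i (j + 1)
    split_ifs with h2 h3
    · refine ⟨?_, h1.2⟩
      rcases hc.2 i with ⟨hh, h⟩ | h
      · exact absurd hh h2.2
      · obtain ⟨-, -, -, h5⟩ := step_eq_some h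
        rw [h2.1, h3] at h5
        have : (c (i + 1)).head = j + 1 := by simpa using h5
        simp [tileAt_succ, this]
    · refine ⟨?_, h1.2⟩
      rcases hc.2 i with ⟨hh, h⟩ | h
      · exact absurd hh h2.2
      · obtain ⟨-, -, -, h5⟩ := step_eq_some h
        rw [h2.1] at h5
        have : (c (i + 1)).head ≠ j + 1 := by
          rcases h5 with h5 | h5
          · exact absurd h5.1 h3
          · omega
        simp [tileAt_succ, this]
    · exact h1
  | L =>
    obtain ⟨rfl, rfl⟩ := h
    rw [cons, consDiag_tileAt hc]
    have h1 := hpl i j'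
    split_ifs with h2 h3
    · refine ⟨?_, h1.2⟩
      rcases hc.2 i with ⟨hh, h⟩ | h
      · exact absurd hh h2.2
      · obtain ⟨-, -, -, h5⟩ := step_eq_some h
        rw [h2.1, h3] at h5
        have : (c (i + 1)).head = j' := by simpa using h5
        simp [tileAt_succ, this]
    · refine ⟨?_, h1.2⟩
      rcases hc.2 i with ⟨hh, h⟩ | h
      · exact absurd hh h2.2
      · obtain ⟨-, -, -, h5⟩ := step_eq_some h
        rw [h2.1] at h5
        have : (c (i + 1)).head ≠ j' := by
          rcases h5 with h5 | h5
          · omega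
          · exact absurd h5.1 h3
        simp [tileAt_succ, this]
    · exact h1

/-! ### The order of the vertices and the greedy choice in each supernode -/

section Order

variable [Fintype Q] [Fintype Γ] (ν : M.Numbering)

theorem Numbering.xstateIdx_injective : Function.Injective ν.xstateIdx := by
  intro p q h
  cases p <;> cases q <;> simp_all [Numbering.xstateIdx, Fin.val_inj]

theorem Numbering.xsymIdx_injective (n : ℕ) :
    Function.Injective (ν.xsymIdx : XSym Γ n → ℕ) := by
  intro p q h
  cases p with
  | special i =>
    cases q with
    | special j => simpa [Numbering.xsymIdx, Fin.val_inj] using h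
    | sym b => simp only [Numbering.xsymIdx] at h; omega
  | sym a =>
    cases q with
    | special j => simp only [Numbering.xsymIdx] at h; omega
    | sym b => simpa [Numbering.xsymIdx, Fin.val_inj] using h

theorem Numbering.prec_iff {n : ℕ} (u v : Node Q Γ n) : ν.prec u v ↔
    u.row < v.row ∨ u.row = v.row ∧ (u.col < v.col ∨ u.col = v.col ∧
      (ν.xstateIdx u.tile.1 < ν.xstateIdx v.tile.1 ∨
        ν.xstateIdx u.tile.1 = ν.xstateIdx v.tile.1 ∧
          ν.xsymIdx u.tile.2 < ν.xsymIdx v.tile.2)) := by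
  simp [Numbering.prec, Prod.Lex.toLex_lt_toLex]

theorem Numbering.prec_trichotomy {n : ℕ} (u v : Node Q Γ n) :
    ν.prec u v ∨ u = v ∨ ν.prec v u := by
  obtain ⟨i, j, p, a⟩ := u
  obtain ⟨i', j', p', a'⟩ := v
  have hp : ν.xstateIdx p = ν.xstateIdx p' → p = p' := fun h => ν.xstateIdx_injective h
  have ha : ν.xsymIdx a = ν.xsymIdx a' → a = a' := fun h => ν.xsymIdx_injective n h
  simp only [ν.prec_iff]
  rcases lt_trichotomy i i' with h | h | h
  · omega
  · rcases lt_trichotomy j j' with h1 | h1 | h1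
    · omega
    · rcases lt_trichotomy (ν.xstateIdx p) (ν.xstateIdx p') with h2 | h2 | h2
      · omega
      · rcases lt_trichotomy (ν.xsymIdx a) (ν.xsymIdx a') with h3 | h3 | h3
        · omega
        · right; left
          rw [h, h1, hp h2, ha h3]
        · omega
      · omega
    · omega
  · omega

theorem Numbering.prec_wellFounded (n : ℕ) :
    WellFounded (ν.prec : Node Q Γ n → Node Q Γ n → Prop) :=
  InvImage.wf (fun u : Node Q Γ n =>
    toLex (u.row, toLex (u.col, toLex (ν.xstateIdx u.tile.1, ν.xsymIdx u.tile.2)))) wellFounded_lt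

/-- A tile that precedes that of the space-time diagram is inconsistent with some parent. -/
theorem exists_not_mem_cons {c : ℕ → Cfg Q Γ} (hc : M.IsFrozenRun x c) (hx : x ≠ []) {T i j : ℕ}
    (hi : i < T) (hj : j < T) (t : Tile Q Γ x.length)
    (ht : ν.xstateIdx t.1 < ν.xstateIdx (tileAt x M c i j).1 ∨
      ν.xstateIdx t.1 = ν.xstateIdx (tileAt x M c i j).1 ∧
        ν.xsymIdx t.2 < ν.xsymIdx (tileAt x M c i j).2) :
    ∃ D i' j', IsParent D (i', j') (i, j) ∧ i' < T ∧ j' < T ∧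
      t ∉ M.cons x D (tileAt x M c i' j') := by
  obtain ⟨p, a⟩ := t
  have hlen : 0 < x.length := List.length_pos_iff.2 hx
  rcases i with _ | i
  · rcases j with _ | j
    -- The corner has no parent, but its correct tile has both indices `0`, so nothing precedes it.
    · simp [tileAt, hlen, Numbering.xstateIdx, Numbering.xsymIdx] at ht
    · refine ⟨.H, 0, j, ⟨rfl, rfl⟩, hi, by omega, fun hmem => ?_⟩
      rw [cons] at hmem
      have hp : p ≠ .start := consH_fst hmem
      -- The correct state is `*`, and only the start state, excluded by horizontal consistency,
      -- precedes it.
      have hps : p = .star := by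
        cases p with
        | start => exact absurd rfl hp
        | star => rfl
        | st q => simp [tileAt, Numbering.xstateIdx] at ht
      subst hps
      have ha : ν.xsymIdx a < ν.xsymIdx (tileAt x M c 0 (j + 1)).2 := by
        simpa [tileAt, Numbering.xstateIdx] using ht
      cases a with
      -- Ordinary symbols come after all special ones, and the blank is the first among them, so
      -- none precedes the correct symbol.
      | sym a =>
        by_cases hj' : j + 1 < x.length
        · simp only [tileAt, hj', Numbering.xsymIdx, dite_true, if_true] at ha
          omega
        · simp [tileAt, hj', Numbering.xsymIdx, ν.symIdx_blank] at ha
      -- The left neighbour allows only the next special symbol, which is then the correct one, or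
      -- none at all.
      | special m =>
        by_cases hj' : j < x.length
        · simp only [tileAt, hj', consH, dite_true, if_true] at hmem
          rcases hmem.2 with ⟨_, h⟩ | ⟨m', hm', h⟩
          · cases h
          · cases h
            have hj2 : j + 1 < x.length := by omega
            simp only [tileAt, hj2, Numbering.xsymIdx, dite_true, if_true] at ha
            omega
        · simp only [tileAt, hj', consH, dite_false, if_true] at hmem
          obtain ⟨_, h⟩ := hmem.2
          cases h
  · by_cases hV : ((p, a) : Tile Q Γ x.length) ∈ M.cons x .V (tileAt x M c i j)
    · rw [cons, consV_tileAt hc] at hV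
      by_cases hh : (c i).head = j
      · rw [if_pos hh] at hV
        have := Set.mem_singleton_iff.1 hV
        rw [this] at ht
        omega
      · rw [if_neg hh] at hV
        obtain ⟨hp, ha⟩ := hV
        have hp : p ≠ .start := hp
        have ha : a = .sym ((c (i + 1)).tape j) := ha
        rw [tileAt_succ, ha] at ht
        -- If the head arrives at this column, it moved there in a real step, and the supernode it
        -- came from is the diagonal parent that forces the state.
        by_cases hh' : (c (i + 1)).head = j
        · rcases hc.2 i with ⟨-, h⟩ | h
          · rw [h] at hh'
            exact absurd hh' hh
          · have hhd := hc.head_le i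
            obtain ⟨h0, h1, h2, ⟨h3, h4⟩ | ⟨h3, h4⟩⟩ := step_eq_some h
            · refine ⟨.R, i, (c i).head, ⟨rfl, by omega⟩, by omega, by omega, fun hmem => ?_⟩
              rw [cons, consDiag_tileAt hc, if_pos ⟨rfl, h0⟩, if_pos h3] at hmem
              have hp' : p = .st (c (i + 1)).state := hmem.1
              rw [if_pos hh', hp'] at ht
              omega
            · refine ⟨.L, i, (c i).head, ⟨rfl, by omega⟩, by omega, by omega, fun hmem => ?_⟩
              rw [cons, consDiag_tileAt hc, if_pos ⟨rfl, h0⟩, if_pos h3] at hmem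
              have hp' : p = .st (c (i + 1)).state := hmem.1
              rw [if_pos hh', hp'] at ht
              omega
        · rw [if_neg hh'] at ht
          cases p with
          | start => exact absurd rfl hp
          | star => simp at ht
          | st q => simp [Numbering.xstateIdx] at ht
    · exact ⟨.V, i, j, ⟨rfl, rfl⟩, by omega, hj, hV⟩

/-- The vertices that form the space-time diagram of `c`. -/
def diagram (x : List α) (M : TM α Q Γ) (T : ℕ) (c : ℕ → Cfg Q Γ) : Set (Node Q Γ x.length) :=
  {v | v ∈ gridVerts Q Γ x.length T ∧ v.tile = tileAt x M c (v.row - 1) (v.col - 1)}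

/-- A vertex off the diagram shares its supernode with the correct tile: either that tile comes
first and the clique excludes the vertex, or the vertex comes first and an inconsistent parent
excludes it. -/
theorem isGreedy_diagram {c : ℕ → Cfg Q Γ} (hc : M.IsFrozenRun x c) (hx : x ≠ []) (T : ℕ) :
    (M.gridGraph x T).IsGreedy ν.prec (diagram x M T c) := by
  have hnoedge : ∀ u ∈ diagram x M T c, ∀ v ∈ diagram x M T c, ¬ (M.gridGraph x T).Edge u v := by
    rintro ⟨i, j, t⟩ ⟨⟨hi, hi', hj, hj'⟩, hu⟩ ⟨i', j', t'⟩ ⟨⟨hi1, hi1', hj1, hj1'⟩, hv⟩ ⟨-, -, h⟩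
    simp only at hi hi' hj hj' hu hi1 hi1' hj1 hj1' hv h
    rcases h with ⟨h1, h2, h3⟩ | ⟨D, hD, h⟩
    · subst h1 h2 hu hv
      exact h3 rfl
    · rw [hu, hv] at h
      refine h (tileAt_mem_cons hc D ?_)
      cases D <;> simp only [IsParent] at hD ⊢ <;> omega
  intro v
  refine ⟨fun hv => ⟨hv.1, fun u hu _ => ⟨hnoedge u hu v hv, hnoedge v hv u hu⟩⟩, ?_⟩
  rintro ⟨hv, hmin⟩
  refine ⟨hv, ?_⟩
  by_contra hne
  obtain ⟨i, j, t⟩ := v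
  have ⟨hi, hi', hj, hj'⟩ := hv
  simp only at hi hi' hj hj' hne
  have hw : (⟨i, j, tileAt x M c (i - 1) (j - 1)⟩ : Node Q Γ x.length) ∈ diagram x M T c :=
    ⟨⟨hi, hi', hj, hj'⟩, rfl⟩
  rcases ν.prec_trichotomy ⟨i, j, tileAt x M c (i - 1) (j - 1)⟩ ⟨i, j, t⟩ with h | h | h
  · refine (hmin _ hw h).1 ⟨hw.1, hv, Or.inl ⟨rfl, rfl, fun h => ?_⟩⟩
    injection h with _ _ h
    exact hne h.symm
  · injection h with _ _ h
    exact hne h.symm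
  · rw [ν.prec_iff] at h
    simp only [lt_irrefl, true_and, false_or] at h
    obtain ⟨D, i', j', hD, hi1, hj1, hmem⟩ := exists_not_mem_cons ν hc hx (T := T) (i := i - 1)
      (j := j - 1) (by omega) (by omega) t h
    have hu : (⟨i' + 1, j' + 1, tileAt x M c i' j'⟩ : Node Q Γ x.length) ∈ diagram x M T c := by
      refine ⟨⟨?_, ?_, ?_, ?_⟩, rfl⟩ <;> simp only <;> omega
    have hpar : IsParent D (i' + 1, j' + 1) (i, j) := by
      cases D <;> simp only [IsParent] at hD ⊢ <;> omega
    refine (hmin _ hu ?_).1 ⟨hu.1, hv, Or.inr ⟨D, hpar, hmem⟩⟩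
    -- Every parent lies in an earlier row, or in the same row further left, so it precedes its
    -- child.
    rw [ν.prec_iff]
    cases D <;> simp only [IsParent] at hpar ⊢ <;> omega
end Order

end TM

/-! ### Digits and words -/

/-- The words of length `k` over `0, …, b - 1`. -/
def words (b k : ℕ) : Set (List ℕ) := {w | w.length = k ∧ ∀ d ∈ w, d < b}

theorem append_mem_words {b m n : ℕ} {u v : List ℕ} (hu : u ∈ words b m) (hv : v ∈ words b n) :
    u ++ v ∈ words b (m + n) := by
  refine ⟨by rw [List.length_append, hu.1, hv.1], fun d hd => ?_⟩
  rcases List.mem_append.1 hd with h | h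
  · exact hu.2 d h
  · exact hv.2 d h

theorem singleton_mem_words {b d : ℕ} : [d] ∈ words b 1 ↔ d < b := by
  simp [words]

theorem mem_words_add {b m n : ℕ} {w : List ℕ} :
    w ∈ words b (m + n) ↔ ∃ u ∈ words b m, ∃ v ∈ words b n, w = u ++ v := by
  refine ⟨fun ⟨h1, h2⟩ => ?_, fun ⟨u, hu, v, hv, h⟩ => h ▸ append_mem_words hu hv⟩
  refine ⟨w.take m, ⟨by simp [h1], fun d hd => h2 d (List.mem_of_mem_take hd)⟩,
    w.drop m, ⟨by simp [h1], fun d hd => h2 d (List.mem_of_mem_drop hd)⟩,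
    (List.take_append_drop m w).symm⟩

theorem mem_words_one {b : ℕ} {w : List ℕ} : w ∈ words b 1 ↔ ∃ d < b, w = [d] := by
  constructor
  · rintro ⟨h1, h2⟩
    obtain ⟨d, rfl⟩ := List.length_eq_one_iff.1 h1
    exact ⟨d, h2 d (by simp), rfl⟩
  · rintro ⟨d, hd, rfl⟩
    exact singleton_mem_words.2 hd

/-- Splitting off the least significant digit matches division with remainder by `b`, on which the
later inductions run. -/
theorem digits_succ (b k m : ℕ) : digits b (k + 1) m = digits b k (m / b) ++ [m % b] := by
  unfold digits
  rw [List.range_succ_eq_map, List.reverse_cons, List.map_append, ← List.map_reverse,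
    List.map_map]
  congr 1
  · refine List.map_congr_left fun i _ => ?_
    simp [Nat.div_div_eq_div_mul, pow_succ']
  · simp

theorem length_digits (b k m : ℕ) : (digits b k m).length = k := by
  simp [digits]

theorem digits_mem_words {b : ℕ} (hb : 0 < b) (k m : ℕ) : digits b k m ∈ words b k := by
  refine ⟨length_digits b k m, fun d hd => ?_⟩
  obtain ⟨i, -, rfl⟩ := List.mem_map.1 hd
  exact Nat.mod_lt _ hb

theorem exists_digits_eq {b k : ℕ} {w : List ℕ} (hw : w ∈ words b k) :
    ∃ m < b ^ k, digits b k m = w := by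
  induction k generalizing w with
  | zero => exact ⟨0, by simp, by rw [List.length_eq_zero_iff.1 hw.1]; rfl⟩
  | succ k ih =>
    obtain ⟨u, hu, v, hv, rfl⟩ := mem_words_add.1 hw
    obtain ⟨d, hd, rfl⟩ := mem_words_one.1 hv
    obtain ⟨m, hm, rfl⟩ := ih hu
    refine ⟨b * m + d, ?_, ?_⟩
    · rw [pow_succ']
      calc b * m + d < b * m + b := by omega
        _ = b * (m + 1) := by ring
        _ ≤ b * b ^ k := Nat.mul_le_mul_left b hm
    · rw [digits_succ, Nat.mul_add_mod, Nat.mod_eq_of_lt hd,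
        Nat.mul_add_div (by omega), Nat.div_eq_of_lt hd, add_zero]

/-- Equal lengths rule out that one prefix is a proper prefix of the other, so the comparison
separates. -/
theorem append_lt_append_iff {l₁ l₂ r₁ r₂ : List ℕ} (h : l₁.length = l₂.length) :
    l₁ ++ r₁ < l₂ ++ r₂ ↔ l₁ < l₂ ∨ l₁ = l₂ ∧ r₁ < r₂ := by
  induction l₁ generalizing l₂ with
  | nil => obtain rfl := List.length_eq_zero_iff.1 h.symm
           simp
  | cons a l₁ ih =>
    cases l₂ with
    | nil => simp at h
    | cons c l₂ =>
      simp only [List.length_cons, Nat.add_right_cancel_iff] at h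
      simp only [List.cons_append, List.cons_lt_cons_iff, ih h, List.cons.injEq]
      tauto

theorem digits_lt_digits_iff {b k m m' : ℕ} (hm : m < b ^ k) (hm' : m' < b ^ k) :
    digits b k m < digits b k m' ↔ m < m' := by
  have key : ∀ k m m', m < b ^ k → m' < b ^ k → m < m' → digits b k m < digits b k m' := by
    intro k
    induction k with
    | zero => intro m m' hm hm' h
              simp at hm'
              omega
    | succ k ih =>
      intro m m' hm hm' h
      rw [digits_succ, digits_succ, append_lt_append_iff (by simp [length_digits])]
      have h1 : m / b < b ^ k := Nat.div_lt_of_lt_mul (by rwa [← pow_succ'])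
      have h2 : m' / b < b ^ k := Nat.div_lt_of_lt_mul (by rwa [← pow_succ'])
      rcases (Nat.div_le_div_right h.le : m / b ≤ m' / b).lt_or_eq with h3 | h3
      · exact Or.inl (ih _ _ h1 h2 h3)
      · refine Or.inr ⟨by rw [h3], List.cons_lt_cons_iff.2 (Or.inl ?_)⟩
        have e1 := Nat.div_add_mod m b
        have e2 := Nat.div_add_mod m' b
        rw [h3] at e1
        omega
  refine ⟨fun h => ?_, key k m m' hm hm'⟩
  rcases lt_trichotomy m m' with h' | h' | h'
  · exact h'
  · rw [h'] at h
    exact absurd h (lt_irrefl _)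
  · exact absurd (h.trans (key k m' m hm' hm h')) (lt_irrefl _)

theorem digits_inj {b k m m' : ℕ} (hm : m < b ^ k) (hm' : m' < b ^ k) :
    digits b k m = digits b k m' ↔ m = m' := by
  refine ⟨fun h => ?_, fun h => by rw [h]⟩
  by_contra hne
  rcases Nat.lt_or_gt_of_ne hne with h' | h'
  · exact absurd ((digits_lt_digits_iff hm hm').2 h') (by rw [h]; exact lt_irrefl _)
  · exact absurd ((digits_lt_digits_iff hm' hm).2 h') (by rw [h]; exact lt_irrefl _)

/-! ### Products of graphs on words of fixed length -/

/-- The fixed length of the left factor makes the splitting of a flattened tuple unique. -/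
theorem DGraph.cart_edge_append {G H : DGraph (List ℕ)} {n : ℕ} (hG : ∀ w ∈ G.verts, w.length = n)
    {u v u' v' : List ℕ} (hu : u ∈ G.verts) (hu' : u' ∈ G.verts) (hv : v ∈ H.verts)
    (hv' : v' ∈ H.verts) : (G.cart H).Edge (u ++ v) (u' ++ v') ↔
      (u = u' ∧ H.Edge v v') ∨ (v = v' ∧ G.Edge u u') := by
  constructor
  · rintro ⟨p, hp, q, -, p', hp', q', -, h, h', hE⟩
    obtain ⟨rfl, rfl⟩ := List.append_inj h (by rw [hG _ hu, hG _ hp])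
    obtain ⟨rfl, rfl⟩ := List.append_inj h' (by rw [hG _ hu', hG _ hp'])
    exact hE
  · exact fun h => ⟨u, hu, v, hv, u', hu', v', hv', rfl, rfl, h⟩

theorem DGraph.tensor_edge_append {G H : DGraph (List ℕ)} {n : ℕ}
    (hG : ∀ w ∈ G.verts, w.length = n) {u v u' v' : List ℕ} (hu : u.length = n)
    (hu' : u'.length = n) :
    (G.tensor H).Edge (u ++ v) (u' ++ v') ↔ G.Edge u u' ∧ H.Edge v v' := by
  constructor
  · rintro ⟨p, hp, q, -, p', hp', q', -, h, h', hE⟩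
    obtain ⟨rfl, rfl⟩ := List.append_inj h (by rw [hu, hG _ hp])
    obtain ⟨rfl, rfl⟩ := List.append_inj h' (by rw [hu', hG _ hp'])
    exact hE
  · rintro ⟨h1, h2⟩
    exact ⟨u, (G.edge_mem h1).1, v, (H.edge_mem h2).1, u', (G.edge_mem h1).2, v',
      (H.edge_mem h2).2, rfl, rfl, h1, h2⟩

theorem InputGraph.toDGraph_verts (A : InputGraph) : A.toDGraph.verts = words A.size 1 := by
  ext w
  rw [mem_words_one]
  exact ⟨fun ⟨i, h⟩ => ⟨i, i.2, h⟩, fun ⟨d, hd, h⟩ => ⟨⟨d, hd⟩, h⟩⟩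

theorem InputGraph.toDGraph_edge (A : InputGraph) (i j : ℕ) :
    A.toDGraph.Edge [i] [j] ↔ ∃ (hi : i < A.size) (hj : j < A.size), A.Edge ⟨i, hi⟩ ⟨j, hj⟩ := by
  constructor
  · rintro ⟨i', j', h, h', hE⟩
    obtain rfl : i = i' := by simpa using h
    obtain rfl : j = j' := by simpa using h'
    exact ⟨i'.2, j'.2, hE⟩
  · rintro ⟨hi, hj, hE⟩
    exact ⟨⟨i, hi⟩, ⟨j, hj⟩, rfl, rfl, hE⟩

theorem cart_verts_words {G H : DGraph (List ℕ)} {b m n : ℕ} (hG : G.verts = words b m)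
    (hH : H.verts = words b n) : (G.cart H).verts = words b (m + n) := by
  ext w
  rw [mem_words_add, ← hG, ← hH]
  rfl

/-! ### Edges of the path and grid formulas -/

namespace Formula

theorem unionUpTo_edge (f : ℕ → Formula) (m : ℕ) (w w' : List ℕ) :
    (unionUpTo f m).eval.Edge w w' ↔ ∃ i ≤ m, (f i).eval.Edge w w' := by
  induction m with
  | zero => simp [unionUpTo]
  | succ m ih =>
    simp only [unionUpTo, eval, DGraph.union, ih, Nat.le_succ_iff]
    constructor
    · rintro (⟨i, hi, h⟩ | h)
      · exact ⟨i, Or.inl hi, h⟩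
      · exact ⟨m + 1, Or.inr rfl, h⟩
    · rintro ⟨i, hi | rfl, h⟩
      · exact Or.inl ⟨i, hi, h⟩
      · exact Or.inr h

theorem unionUpTo_verts {f : ℕ → Formula} {m : ℕ} {S : Set (List ℕ)}
    (h : ∀ i ≤ m, (f i).eval.verts = S) : (unionUpTo f m).eval.verts = S := by
  induction m with
  | zero => exact h 0 le_rfl
  | succ m ih =>
    simp [unionUpTo, eval, DGraph.union, ih fun i hi => h i (by omega), h (m + 1) le_rfl]

theorem cartPrefix_verts {A : InputGraph} (m : ℕ) {n : ℕ} {f : Formula}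
    (hf : f.eval.verts = words A.size n) :
    (cartPrefix A m f).eval.verts = words A.size (m + n) := by
  induction m with
  | zero => simpa [cartPrefix] using hf
  | succ m ih =>
    have := cart_verts_words A.toDGraph_verts ih
    rwa [← add_assoc, add_comm 1 m] at this

/-- An edgeless factor cannot move in a Cartesian product, so its coordinate stays constant along
every edge. -/
theorem cartPrefix_edge (b m : ℕ) (f : Formula) (w w' : List ℕ) :
    (cartPrefix (emptyInput b) m f).eval.Edge w w' ↔
      ∃ p ∈ words b m, ∃ u u', w = p ++ u ∧ w' = p ++ u' ∧ f.eval.Edge u u' := by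
  induction m generalizing w w' with
  | zero =>
    refine ⟨fun h => ⟨[], by simp [words], w, w', rfl, rfl, h⟩, ?_⟩
    rintro ⟨p, hp, u, u', rfl, rfl, h⟩
    obtain rfl := List.length_eq_zero_iff.1 hp.1
    exact h
  | succ m ih =>
    constructor
    · rintro ⟨q, hq, v, -, q', -, v', -, rfl, rfl, ⟨rfl, h⟩ | ⟨-, _, _, -, -, h⟩⟩
      · obtain ⟨p, hp, u, u', rfl, rfl, hf⟩ := (ih _ _).1 h
        have hq : q ∈ (emptyInput b).toDGraph.verts := hq
        rw [InputGraph.toDGraph_verts] at hq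
        refine ⟨q ++ p, ?_, u, u', by simp, by simp, hf⟩
        rw [add_comm m 1]
        exact append_mem_words hq hp
      · exact h.elim
    · rintro ⟨p, hp, u, u', rfl, rfl, h⟩
      rw [add_comm m 1] at hp
      obtain ⟨q, hq, p, hp', rfl⟩ := mem_words_add.1 hp
      have hE := (ih (p ++ u) (p ++ u')).2 ⟨p, hp', u, u', rfl, rfl, h⟩
      have hq' : q ∈ (emptyInput b).toDGraph.verts := by
        rw [InputGraph.toDGraph_verts]
        exact hq
      exact ⟨q, hq', p ++ u, (DGraph.edge_mem _ hE).1, q, hq', p ++ u', (DGraph.edge_mem _ hE).2,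
        by simp, by simp, Or.inl ⟨rfl, hE⟩⟩

theorem emptyPow_verts (b : ℕ) {k : ℕ} (hk : 1 ≤ k) : (emptyPow b k).eval.verts = words b k := by
  have := cartPrefix_verts (A := emptyInput b) (k - 1) (n := 1) (f := .input (emptyInput b))
    (InputGraph.toDGraph_verts _)
  rw [Nat.sub_add_cancel hk] at this
  exact this

theorem emptyPow_edge (b k : ℕ) (w w' : List ℕ) : ¬ (emptyPow b k).eval.Edge w w' := by
  unfold emptyPow
  rw [cartPrefix_edge]
  rintro ⟨p, -, u, u', -, -, _, _, -, -, h⟩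
  exact h

theorem tensorSuffix_verts {B C : InputGraph} (hBC : C.size = B.size) (i : ℕ) :
    (tensorSuffix C i (.input B)).eval.verts = words B.size (i + 1) := by
  induction i with
  | zero => exact B.toDGraph_verts
  | succ i ih =>
    have hC := C.toDGraph_verts
    rw [hBC] at hC
    -- Both products have the same vertex set by definition, so the Cartesian lemma also serves the
    -- tensor product.
    exact cart_verts_words ih hC

/-- This is a carry through exactly `i` digits: `B` raises one digit while each `C` wraps a `b - 1`
to `0`. -/
theorem tensorSuffix_edge (b i : ℕ) (w w' : List ℕ) :
    (tensorSuffix (wrapInput b) i (.input (succInput b))).eval.Edge w w' ↔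
      ∃ d, d + 1 < b ∧ w = d :: List.replicate i (b - 1) ∧
        w' = (d + 1) :: List.replicate i 0 := by
  induction i generalizing w w' with
  | zero =>
    constructor
    · rintro ⟨d, e, rfl, rfl, h⟩
      have h : (e : ℕ) = d + 1 := h
      exact ⟨d, by rw [← h]; exact e.2, rfl, by rw [h]; rfl⟩
    · rintro ⟨d, hd, rfl, rfl⟩
      exact ⟨⟨d, (Nat.lt_succ_self d).trans hd⟩, ⟨d + 1, hd⟩, rfl, rfl, rfl⟩
  | succ i ih =>
    constructor
    · rintro ⟨u, -, v, -, u', -, v', -, rfl, rfl, hu, d, e, rfl, rfl, h1, h2⟩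
      obtain ⟨f, hf, rfl, rfl⟩ := (ih _ _).1 hu
      refine ⟨f, hf, ?_, ?_⟩
      · simp [List.replicate_succ', Nat.eq_sub_of_add_eq h1]
      · simp [List.replicate_succ', h2]
    · rintro ⟨d, hd, rfl, rfl⟩
      have hE := (ih _ _).2 ⟨d, hd, rfl, rfl⟩
      have hw : (wrapInput b).toDGraph.Edge [b - 1] [0] := by
        rw [InputGraph.toDGraph_edge]
        have hb : b - 1 < b := by omega
        have hb' : 0 < b := by omega
        exact ⟨hb, hb', Nat.sub_add_cancel hb', rfl⟩
      exact ⟨_, (DGraph.edge_mem _ hE).1, _, (DGraph.edge_mem _ hw).1, _, (DGraph.edge_mem _ hE).2,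
        _, (DGraph.edge_mem _ hw).2, by simp [List.replicate_succ'],
        by simp [List.replicate_succ'], hE, hw⟩

theorem tensorSuffix_reverse_edge (B C : InputGraph) (i : ℕ) (w w' : List ℕ) :
    (tensorSuffix C.reverse i (.input B.reverse)).eval.Edge w w' ↔
      (tensorSuffix C i (.input B)).eval.Edge w' w := by
  have hin : ∀ (A : InputGraph) w w', A.reverse.toDGraph.Edge w w' ↔ A.toDGraph.Edge w' w :=
    fun A w w' => ⟨fun ⟨i, j, h, h', hE⟩ => ⟨j, i, h', h, hE⟩,
      fun ⟨i, j, h, h', hE⟩ => ⟨j, i, h', h, hE⟩⟩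
  induction i generalizing w w' with
  | zero => exact hin B w w'
  | succ i ih =>
    constructor
    · rintro ⟨u, -, v, -, u', -, v', -, rfl, rfl, hu, hv⟩
      have hu := (ih _ _).1 hu
      have hv := (hin C _ _).1 hv
      exact ⟨u', (DGraph.edge_mem _ hu).1, v', (DGraph.edge_mem _ hv).1, u,
        (DGraph.edge_mem _ hu).2, v, (DGraph.edge_mem _ hv).2, rfl, rfl, hu, hv⟩
    · rintro ⟨u, -, v, -, u', -, v', -, rfl, rfl, hu, hv⟩
      have hu := (ih _ _).2 hu
      have hv := (hin C _ _).2 hv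
      exact ⟨u', (DGraph.edge_mem _ hu).1, v', (DGraph.edge_mem _ hv).1, u,
        (DGraph.edge_mem _ hu).2, v, (DGraph.edge_mem _ hv).2, rfl, rfl, hu, hv⟩

theorem pathOf_verts {b k : ℕ} (hk : 1 ≤ k) {B C : InputGraph} (hB : B.size = b)
    (hC : C.size = b) : (pathOf b k B C).eval.verts = words b k := by
  subst hB
  refine unionUpTo_verts fun i hi => ?_
  have := cartPrefix_verts (A := emptyInput B.size) (k - i - 1) (tensorSuffix_verts hC i)
  rwa [show k - i - 1 + (i + 1) = k by omega] at this

theorem pathOf_edge {b k : ℕ} (B C : InputGraph) (hk : 1 ≤ k) (w w' : List ℕ) :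
    (pathOf b k B C).eval.Edge w w' ↔ ∃ i < k, ∃ p ∈ words b (k - i - 1), ∃ u u',
      w = p ++ u ∧ w' = p ++ u' ∧ (tensorSuffix C i (.input B)).eval.Edge u u' := by
  unfold pathOf
  rw [unionUpTo_edge]
  simp only [cartPrefix_edge]
  exact exists_congr fun i => and_congr_left fun _ => by omega

theorem decPath_edge {b k : ℕ} (hk : 1 ≤ k) (w w' : List ℕ) :
    (decPath b k).eval.Edge w w' ↔ (incPath b k).eval.Edge w' w := by
  unfold decPath incPath
  rw [pathOf_edge _ _ hk, pathOf_edge _ _ hk]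
  simp only [tensorSuffix_reverse_edge]
  constructor
  · rintro ⟨i, hi, p, hp, u, u', h, h', hE⟩
    exact ⟨i, hi, p, hp, u', u, h', h, hE⟩
  · rintro ⟨i, hi, p, hp, u, u', h, h', hE⟩
    exact ⟨i, hi, p, hp, u', u, h', h, hE⟩

/-- The position `i` is the length of the carry. The induction removes the last digit: without a
carry (`i = 0`) only that digit grows; otherwise it wraps and the quotient by `b` increases by one.
-/
theorem succ_digits_iff {b k : ℕ} (hb : 2 ≤ b) {m m' : ℕ} (hm : m < b ^ k) (hm' : m' < b ^ k) :
    (∃ i < k, ∃ p ∈ words b (k - i - 1), ∃ d, d + 1 < b ∧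
      digits b k m = p ++ d :: List.replicate i (b - 1) ∧
      digits b k m' = p ++ (d + 1) :: List.replicate i 0) ↔ m' = m + 1 := by
  induction k generalizing m m' with
  | zero =>
    simp only [pow_zero, Nat.lt_one_iff] at hm hm'
    simp [hm, hm']
  | succ k ih =>
    have h1 : m / b < b ^ k := Nat.div_lt_of_lt_mul (by rwa [← pow_succ'])
    have h2 : m' / b < b ^ k := Nat.div_lt_of_lt_mul (by rwa [← pow_succ'])
    have e1 := Nat.div_add_mod m b
    have e2 := Nat.div_add_mod m' b
    have l1 := Nat.mod_lt m (show b > 0 by omega)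
    have l2 := Nat.mod_lt m' (show b > 0 by omega)
    have hstep : m' = m + 1 ↔ (m / b = m' / b ∧ m' % b = m % b + 1) ∨
        (m' / b = m / b + 1 ∧ m % b = b - 1 ∧ m' % b = 0) := by
      constructor
      · rintro rfl
        rcases Nat.lt_or_ge (m % b + 1) b with h | h
        · left
          have : (m + 1) / b = m / b := by
            rw [Nat.div_eq_of_lt_le]
            · rw [mul_comm]; omega
            · rw [Nat.succ_mul, mul_comm]; omega
          rw [this] at e2
          exact ⟨this.symm, by omega⟩
        · right
          have : (m + 1) / b = m / b + 1 := by
            rw [Nat.div_eq_of_lt_le]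
            · rw [Nat.succ_mul, mul_comm]; omega
            · rw [Nat.succ_mul, Nat.succ_mul, mul_comm]; omega
          rw [this, mul_add] at e2
          exact ⟨this, by omega, by omega⟩
      · rintro (⟨h3, h4⟩ | ⟨h3, h4, h5⟩)
        · rw [h3] at e1
          omega
        · rw [h3, mul_add] at e2
          omega
    rw [hstep, ← ih h1 h2, ← digits_inj h1 h2, digits_succ, digits_succ]
    constructor
    · rintro ⟨i, hi, p, hp, d, hd, h, h'⟩
      rcases i with _ | i
      · obtain ⟨h3, h4⟩ := List.append_inj' h rfl
        obtain ⟨h5, h6⟩ := List.append_inj' h' rfl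
        simp only [List.replicate_zero, List.cons.injEq, and_true] at h4 h6
        exact Or.inl ⟨h3.trans h5.symm, by omega⟩
      · rw [List.replicate_succ', ← List.cons_append, ← List.append_assoc] at h h'
        obtain ⟨h3, h4⟩ := List.append_inj' h rfl
        obtain ⟨h5, h6⟩ := List.append_inj' h' rfl
        refine Or.inr ⟨⟨i, by omega, p, ?_, d, hd, h3, h5⟩, by simpa using h4, by simpa using h6⟩
        rwa [show k + 1 - (i + 1) - 1 = k - i - 1 by omega] at hp
    · rintro (⟨h3, h4⟩ | ⟨⟨i, hi, p, hp, d, hd, h, h'⟩, h4, h5⟩)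
      · refine ⟨0, by omega, digits b k (m / b), ?_, m % b, by omega, rfl, ?_⟩
        · exact digits_mem_words (by omega) _ _
        · rw [h3, h4]; rfl
      · refine ⟨i + 1, by omega, p, ?_, d, hd, ?_, ?_⟩
        · rwa [show k + 1 - (i + 1) - 1 = k - i - 1 by omega]
        · rw [List.replicate_succ', h, h4]; simp
        · rw [List.replicate_succ', h', h5]; simp

theorem incPath_edge {b k : ℕ} (hb : 2 ≤ b) (hk : 1 ≤ k) {m m' : ℕ} (hm : m < b ^ k)
    (hm' : m' < b ^ k) :
    (incPath b k).eval.Edge (digits b k m) (digits b k m') ↔ m' = m + 1 := by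
  rw [← succ_digits_iff hb hm hm', incPath, pathOf_edge _ _ hk]
  simp only [tensorSuffix_edge]
  refine exists_congr fun i => and_congr_right fun _ => exists_congr fun p =>
    and_congr_right fun _ => ?_
  constructor
  · rintro ⟨u, u', h, h', d, hd, rfl, rfl⟩
    exact ⟨d, hd, h, h'⟩
  · rintro ⟨d, hd, h, h'⟩
    exact ⟨_, _, h, h', d, hd, rfl, rfl⟩

theorem grid_verts {b k : ℕ} (hk : 1 ≤ k) (D : GDir) :
    (grid b k D).eval.verts = words b (k + k) := by
  have h1 : (incPath b k).eval.verts = words b k := pathOf_verts hk rfl rfl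
  have h2 : (decPath b k).eval.verts = words b k := pathOf_verts hk rfl rfl
  have h3 := emptyPow_verts b hk
  cases D with
  | V => exact cart_verts_words h1 h3
  | H => exact cart_verts_words h3 h1
  | R => exact cart_verts_words h1 h1
  | L => exact cart_verts_words h1 h2

theorem grid_edge {b k : ℕ} (hb : 2 ≤ b) (hk : 1 ≤ k) (D : GDir) {i j i' j' : ℕ}
    (hi : i < b ^ k) (hj : j < b ^ k) (hi' : i' < b ^ k) (hj' : j' < b ^ k) :
    (grid b k D).eval.Edge (digits b k i ++ digits b k j) (digits b k i' ++ digits b k j') ↔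
      IsParent D (i, j) (i', j') := by
  have h1 : (incPath b k).eval.verts = words b k := pathOf_verts hk rfl rfl
  have h3 := emptyPow_verts b hk
  have hd : ∀ m, digits b k m ∈ words b k := digits_mem_words (by omega) k
  have hl : ∀ m, (digits b k m).length = k := length_digits b k
  have l1 : ∀ w ∈ (incPath b k).eval.verts, w.length = k := fun w hw => (h1 ▸ hw : w ∈ words b k).1
  have l3 : ∀ w ∈ (emptyPow b k).eval.verts, w.length = k :=
    fun w hw => (h3 ▸ hw : w ∈ words b k).1
  cases D with
  | V =>
    rw [grid, eval, DGraph.cart_edge_append l1 (h1 ▸ hd _) (h1 ▸ hd _) (h3 ▸ hd _) (h3 ▸ hd _)]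
    simp only [emptyPow_edge, incPath_edge hb hk hi hi', digits_inj hj hj', IsParent,
      and_false, false_or]
    omega
  | H =>
    rw [grid, eval, DGraph.cart_edge_append l3 (h3 ▸ hd _) (h3 ▸ hd _) (h1 ▸ hd _) (h1 ▸ hd _)]
    simp only [emptyPow_edge, incPath_edge hb hk hj hj', digits_inj hi hi', IsParent,
      and_false, or_false]
    omega
  | R =>
    rw [grid, eval, DGraph.tensor_edge_append l1 (hl _) (hl _)]
    simp only [incPath_edge hb hk hj hj', incPath_edge hb hk hi hi', IsParent]
  | L =>
    rw [grid, eval, DGraph.tensor_edge_append l1 (hl _) (hl _)]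
    simp only [decPath_edge hk, incPath_edge hb hk hj' hj, incPath_edge hb hk hi hi', IsParent]
    omega

/-! ### Complexity -/

theorem cartPrefix_ops (A : InputGraph) (m : ℕ) (f : Formula) :
    (cartPrefix A m f).ops = f.ops + m := by
  induction m with
  | zero => rfl
  | succ m ih => simp only [cartPrefix, ops, ih]; omega

theorem tensorSuffix_ops (C : InputGraph) (m : ℕ) (f : Formula) :
    (tensorSuffix C m f).ops = f.ops + m := by
  induction m with
  | zero => rfl
  | succ m ih => simp only [tensorSuffix, ops, ih]; omega

theorem unionUpTo_ops {f : ℕ → Formula} {m r : ℕ} (h : ∀ i ≤ m, (f i).ops = r) :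
    (unionUpTo f m).ops = (m + 1) * r + m := by
  induction m with
  | zero => simp [unionUpTo, h 0 le_rfl]
  | succ m ih =>
    rw [unionUpTo, ops, ih fun i hi => h i (by omega), h (m + 1) le_rfl]
    ring

theorem emptyPow_ops (b k : ℕ) : (emptyPow b k).ops = k - 1 := by
  simp [emptyPow, cartPrefix_ops, ops]

/-- Stated for `k + 1` to avoid truncated subtraction: `k + 1` terms of `k` operations each, joined
by `k` unions. -/
theorem pathOf_ops (b k : ℕ) (B C : InputGraph) :
    (pathOf b (k + 1) B C).ops = (k + 1) * k + k := by
  refine unionUpTo_ops fun i hi => ?_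
  rw [cartPrefix_ops, tensorSuffix_ops, ops]
  omega

theorem cartPrefix_inputsLE {n : ℕ} {A : InputGraph} (hA : A.size ≤ n) (m : ℕ) {f : Formula}
    (hf : f.InputsLE n) : (cartPrefix A m f).InputsLE n := by
  induction m with
  | zero => exact hf
  | succ m ih => exact ⟨hA, ih⟩

theorem tensorSuffix_inputsLE {n : ℕ} {C : InputGraph} (hC : C.size ≤ n) (m : ℕ) {f : Formula}
    (hf : f.InputsLE n) : (tensorSuffix C m f).InputsLE n := by
  induction m with
  | zero => exact hf
  | succ m ih => exact ⟨ih, hC⟩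

theorem unionUpTo_inputsLE {n : ℕ} {f : ℕ → Formula} (h : ∀ i, (f i).InputsLE n) (m : ℕ) :
    (unionUpTo f m).InputsLE n := by
  induction m with
  | zero => exact h 0
  | succ m ih => exact ⟨ih, h _⟩

theorem emptyPow_inputsLE {b n : ℕ} (hb : b ≤ n) (k : ℕ) : (emptyPow b k).InputsLE n :=
  cartPrefix_inputsLE (A := emptyInput b) hb _ (f := .input (emptyInput b)) hb

theorem pathOf_inputsLE {b n : ℕ} (hb : b ≤ n) (k : ℕ) {B C : InputGraph} (hB : B.size ≤ n)
    (hC : C.size ≤ n) : (pathOf b k B C).InputsLE n :=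
  unionUpTo_inputsLE (fun _ => cartPrefix_inputsLE (A := emptyInput b) hb _
    (tensorSuffix_inputsLE hC _ (f := .input B) hB)) _

theorem grid_inputsLE {b n : ℕ} (hb : b ≤ n) (k : ℕ) (D : GDir) : (grid b k D).InputsLE n := by
  have h1 : (incPath b k).InputsLE n := pathOf_inputsLE hb k hb hb
  have h2 : (decPath b k).InputsLE n := pathOf_inputsLE hb k hb hb
  have h3 := emptyPow_inputsLE hb k
  cases D <;> exact ⟨by assumption, by assumption⟩

end Formula

/-! ### Complexity of the factored graph and the numbering of tiles -/

namespace TM.Numbering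

variable {α Q Γ : Type} [Fintype Q] [Fintype Γ] {M : TM α Q Γ} (ν : M.Numbering) (x : List α)

/-- Each path has `k ^ 2 - 1` operations and there are six of them, one in each of `V` and `H` and
two in each of `R` and `L`. The edgeless powers and the connecting operations give the linear and
constant terms. -/
theorem factored_hasComplexity (b : ℕ) {k : ℕ} (hk : 1 ≤ k) :
    (ν.factored x b k).HasComplexity
      (max b ((Fintype.card Q + 2) * (Fintype.card Γ + x.length))) (6 * k ^ 2 + 4 * k + 5) := by
  set n := max b ((Fintype.card Q + 2) * (Fintype.card Γ + x.length)) with hn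
  have hb : b ≤ n := le_max_left _ _
  have ht : ν.tileCount x.length ≤ n := le_max_right _ _
  have hE := Formula.emptyPow_inputsLE hb k
  have hG := Formula.grid_inputsLE hb k
  refine ⟨⟨⟨⟨hE, hE⟩, ht⟩, ⟨⟨⟨hG _, ht⟩, ⟨hG _, ht⟩⟩, ⟨hG _, ht⟩⟩, ⟨hG _, ht⟩⟩, ?_⟩
  obtain ⟨k, rfl⟩ := Nat.exists_eq_add_of_le' hk
  simp only [factored, superGrid, Formula.ops, Formula.grid, Formula.incPath, Formula.decPath,
    Formula.pathOf_ops, Formula.emptyPow_ops, Nat.add_sub_cancel]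
  ring

theorem xstateIdx_lt (p : XState Q) : ν.xstateIdx p < Fintype.card Q + 2 := by
  cases p with
  | start => simp [xstateIdx]
  | star => simp [xstateIdx]
  | st q => simp [xstateIdx]

theorem xsymIdx_lt {n : ℕ} (a : XSym Γ n) : ν.xsymIdx a < Fintype.card Γ + n := by
  cases a with
  | special i => simp only [xsymIdx]; omega
  | sym a => have := (ν.symIdx a).2; simp only [xsymIdx]; omega

theorem tileIdx_lt {n : ℕ} (t : Tile Q Γ n) : ν.tileIdx t < ν.tileCount n := by
  have h1 := ν.xstateIdx_lt t.1
  have h2 := ν.xsymIdx_lt t.2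
  unfold tileIdx tileCount
  calc _ < ν.xstateIdx t.1 * (Fintype.card Γ + n) + (Fintype.card Γ + n) := by omega
    _ = (ν.xstateIdx t.1 + 1) * (Fintype.card Γ + n) := by ring
    _ ≤ _ := Nat.mul_le_mul_right _ h1

/-- The symbol index is smaller than the multiplier of the state index, so the state always
dominates. -/
theorem tileIdx_lt_tileIdx_iff {n : ℕ} (t t' : Tile Q Γ n) : ν.tileIdx t < ν.tileIdx t' ↔
    ν.xstateIdx t.1 < ν.xstateIdx t'.1 ∨
      ν.xstateIdx t.1 = ν.xstateIdx t'.1 ∧ ν.xsymIdx t.2 < ν.xsymIdx t'.2 := by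
  have h1 := ν.xsymIdx_lt t.2
  have h2 := ν.xsymIdx_lt t'.2
  unfold tileIdx
  have key : ∀ p q a a' N : ℕ, a < N → a' < N → p < q → p * N + a < q * N + a' := by
    intro p q a a' N ha ha' hpq
    calc _ < p * N + N := by omega
      _ = (p + 1) * N := by ring
      _ ≤ q * N := Nat.mul_le_mul_right _ hpq
      _ ≤ _ := Nat.le_add_right _ _
  rcases lt_trichotomy (ν.xstateIdx t.1) (ν.xstateIdx t'.1) with h | h | h
  · exact ⟨fun _ => Or.inl h, fun _ => key _ _ _ _ _ h1 h2 h⟩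
  · rw [h]; omega
  · have := key _ _ _ _ _ h2 h1 h
    omega

theorem exists_tileIdx_eq {n m : ℕ} (hm : m < ν.tileCount n) :
    ∃ t : Tile Q Γ n, ν.tileIdx t = m := by
  have hp : ∀ p < Fintype.card Q + 2, ∃ s : XState Q, ν.xstateIdx s = p := by
    intro p hp
    rcases p with _ | _ | p
    · exact ⟨.start, rfl⟩
    · exact ⟨.star, rfl⟩
    · exact ⟨.st (ν.stateIdx.symm ⟨p, by omega⟩), by simp [xstateIdx]⟩
  have ha : ∀ a < Fintype.card Γ + n, ∃ s : XSym Γ n, ν.xsymIdx s = a := by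
    intro a ha
    rcases Nat.lt_or_ge a n with h | h
    · exact ⟨.special ⟨a, h⟩, rfl⟩
    · exact ⟨.sym (ν.symIdx.symm ⟨a - n, by omega⟩), by simp [xsymIdx]; omega⟩
  unfold tileCount at hm
  have hpos : 0 < Fintype.card Γ + n := Nat.pos_of_ne_zero fun h => by simp [h] at hm
  obtain ⟨p, hp⟩ := hp (m / (Fintype.card Γ + n)) (Nat.div_lt_of_lt_mul (by rwa [mul_comm]))
  obtain ⟨a, ha⟩ := ha (m % (Fintype.card Γ + n)) (Nat.mod_lt _ hpos)
  refine ⟨(p, a), ?_⟩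
  rw [tileIdx, hp, ha, mul_comm]
  exact Nat.div_add_mod _ _

end TM.Numbering

/-! ### The ordered isomorphism from the grid graph to the factored graph -/

namespace TM.Numbering

variable {α Q Γ : Type} [Fintype Q] [Fintype Γ] {M : TM α Q Γ} (ν : M.Numbering) (x : List α)

theorem tileIdx_inj {n : ℕ} {t t' : Tile Q Γ n} : ν.tileIdx t = ν.tileIdx t' ↔ t = t' := by
  refine ⟨fun h => ?_, fun h => by rw [h]⟩
  have h1 := (ν.tileIdx_lt_tileIdx_iff t t').not.1 (by omega)
  have h2 := (ν.tileIdx_lt_tileIdx_iff t' t).not.1 (by omega)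
  exact Prod.ext (ν.xstateIdx_injective (by omega)) (ν.xsymIdx_injective n (by omega))

theorem relInput_edge (D : GDir) (t t' : Tile Q Γ x.length) :
    (ν.relInput x D).toDGraph.Edge [ν.tileIdx t] [ν.tileIdx t'] ↔ t' ∉ M.cons x D t := by
  rw [InputGraph.toDGraph_edge]
  constructor
  · rintro ⟨_, _, s, s', h, h', hE⟩
    rwa [ν.tileIdx_inj.1 h, ν.tileIdx_inj.1 h'] at hE
  · exact fun h => ⟨ν.tileIdx_lt t, ν.tileIdx_lt t', t, t', rfl, rfl, h⟩

theorem completeInput_edge {n : ℕ} (t t' : Tile Q Γ n) :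
    (completeInput (ν.tileCount n)).toDGraph.Edge [ν.tileIdx t] [ν.tileIdx t'] ↔ t ≠ t' := by
  rw [InputGraph.toDGraph_edge]
  constructor
  · rintro ⟨_, _, h⟩ rfl
    exact h rfl
  · exact fun h => ⟨ν.tileIdx_lt t, ν.tileIdx_lt t', fun h' => h (ν.tileIdx_inj.1 (Fin.ext_iff.1 h'))⟩

theorem factored_verts {b k : ℕ} (hk : 1 ≤ k) :
    (ν.factored x b k).eval.verts =
      {w | ∃ u ∈ words b (k + k), ∃ v ∈ words (ν.tileCount x.length) 1, w = u ++ v} := by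
  have hE := Formula.emptyPow_verts b hk
  have hs : ∀ D, (ν.superGrid x b k D).eval.verts =
      {w | ∃ u ∈ words b (k + k), ∃ v ∈ words (ν.tileCount x.length) 1, w = u ++ v} := fun D => by
    rw [← Formula.grid_verts hk D, ← show _ = words (ν.tileCount x.length) 1 from
      (ν.relInput x D).toDGraph_verts]
    rfl
  have h0 : (Formula.cart (.cart (.emptyPow b k) (.emptyPow b k))
      (.input (completeInput (ν.tileCount x.length)))).eval.verts =
      {w | ∃ u ∈ words b (k + k), ∃ v ∈ words (ν.tileCount x.length) 1, w = u ++ v} := by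
    rw [← cart_verts_words hE hE, ← show _ = words (ν.tileCount x.length) 1 from
      (completeInput (ν.tileCount x.length)).toDGraph_verts]
    rfl
  change _ ∪ (((_ ∪ _) ∪ _) ∪ _) = _
  rw [h0, hs, hs, hs, hs]
  simp only [Set.union_self]

/-- The Cartesian product with the complete graph yields the cliques, because its grid factor has no
edges; the four tensor products yield the inconsistent pairs of neighbours. -/
theorem factored_edge {b k : ℕ} (hb : 2 ≤ b) (hk : 1 ≤ k) {i j i' j' : ℕ}
    (hi : i < b ^ k) (hj : j < b ^ k) (hi' : i' < b ^ k) (hj' : j' < b ^ k)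
    (t t' : Tile Q Γ x.length) :
    (ν.factored x b k).eval.Edge ((digits b k i ++ digits b k j) ++ [ν.tileIdx t])
        ((digits b k i' ++ digits b k j') ++ [ν.tileIdx t']) ↔
      (i = i' ∧ j = j' ∧ t ≠ t') ∨
        ∃ D, IsParent D (i, j) (i', j') ∧ t' ∉ M.cons x D t := by
  have hd : ∀ m, digits b k m ∈ words b k := digits_mem_words (by omega) k
  have hg : ∀ m m', digits b k m ++ digits b k m' ∈ words b (k + k) :=
    fun m m' => append_mem_words (hd m) (hd m')
  have hE := Formula.emptyPow_verts b hk
  have hEE := cart_verts_words hE hE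
  have hl : ∀ {G : DGraph (List ℕ)}, G.verts = words b (k + k) →
    ∀ w ∈ G.verts, w.length = k + k := fun h w hw => (h ▸ hw : w ∈ words b (k + k)).1
  have hs : ∀ D, (ν.superGrid x b k D).eval.Edge ((digits b k i ++ digits b k j) ++ [ν.tileIdx t])
      ((digits b k i' ++ digits b k j') ++ [ν.tileIdx t']) ↔
      IsParent D (i, j) (i', j') ∧ t' ∉ M.cons x D t := fun D => by
    have h1 := DGraph.tensor_edge_append (H := (ν.relInput x D).toDGraph)
      (hl (Formula.grid_verts hk D)) (hg i j).1 (hg i' j').1 (v := [ν.tileIdx t])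
      (v' := [ν.tileIdx t'])
    rw [Formula.grid_edge hb hk D hi hj hi' hj', relInput_edge] at h1
    exact h1
  have h0 : (Formula.cart (.cart (.emptyPow b k) (.emptyPow b k))
      (.input (completeInput (ν.tileCount x.length)))).eval.Edge
      ((digits b k i ++ digits b k j) ++ [ν.tileIdx t])
      ((digits b k i' ++ digits b k j') ++ [ν.tileIdx t']) ↔ i = i' ∧ j = j' ∧ t ≠ t' := by
    have hv : ∀ t : Tile Q Γ x.length,
        [ν.tileIdx t] ∈ (completeInput (ν.tileCount x.length)).toDGraph.verts :=
      fun t => ⟨⟨_, ν.tileIdx_lt t⟩, rfl⟩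
    have h1 := DGraph.cart_edge_append (H := (completeInput (ν.tileCount x.length)).toDGraph)
      (hl hEE) (hEE ▸ hg i j) (hEE ▸ hg i' j') (hv t) (hv t')
    have h2 : ¬ ((Formula.emptyPow b k).eval.cart (Formula.emptyPow b k).eval).Edge
        (digits b k i ++ digits b k j) (digits b k i' ++ digits b k j') := by
      rintro ⟨_, -, _, -, _, -, _, -, -, -, ⟨-, h⟩ | ⟨-, h⟩⟩ <;> exact Formula.emptyPow_edge _ _ _ _ h
    rw [completeInput_edge] at h1
    refine h1.trans ?_
    simp only [h2, and_false, or_false]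
    constructor
    · rintro ⟨h, ht⟩
      obtain ⟨h3, h4⟩ := List.append_inj h (by simp [length_digits])
      exact ⟨(digits_inj hi hi').1 h3, (digits_inj hj hj').1 h4, ht⟩
    · rintro ⟨rfl, rfl, ht⟩
      exact ⟨rfl, ht⟩
  change (_ ∨ (((_ ∨ _) ∨ _) ∨ _)) ↔ _
  rw [h0, hs, hs, hs, hs]
  refine or_congr_right ⟨?_, ?_⟩
  · rintro (((h | h) | h) | h) <;> exact ⟨_, h⟩
  · rintro ⟨D, h⟩
    cases D
    · exact Or.inl (Or.inl (Or.inl h))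
    · exact Or.inl (Or.inl (Or.inr h))
    · exact Or.inl (Or.inr h)
    · exact Or.inr h

theorem gridGraph_isOrderedIso {b k : ℕ} (hb : 2 ≤ b) (hk : 1 ≤ k) :
    (M.gridGraph x (b ^ k)).IsOrderedIso ν.prec (ν.factored x b k).eval (· < ·) (ν.code b k) := by
  have hd : ∀ m, digits b k m ∈ words b k := digits_mem_words (by omega) k
  have hlt : ∀ u ∈ gridVerts Q Γ x.length (b ^ k), ∀ v ∈ gridVerts Q Γ x.length (b ^ k),
      (ν.prec u v ↔ ν.code b k u < ν.code b k v) := by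
    rintro u ⟨hu1, hu2, hu3, hu4⟩ v ⟨hv1, hv2, hv3, hv4⟩
    have a1 : u.row - 1 < b ^ k := by omega
    have a2 : u.col - 1 < b ^ k := by omega
    have a3 : v.row - 1 < b ^ k := by omega
    have a4 : v.col - 1 < b ^ k := by omega
    unfold code
    rw [append_lt_append_iff (by simp [length_digits]),
      append_lt_append_iff (by simp [length_digits]), digits_lt_digits_iff a1 a3,
      digits_lt_digits_iff a2 a4, digits_inj a1 a3]
    have happ : digits b k (u.row - 1) ++ digits b k (u.col - 1) =
        digits b k (v.row - 1) ++ digits b k (v.col - 1) ↔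
          u.row - 1 = v.row - 1 ∧ u.col - 1 = v.col - 1 := by
      rw [← digits_inj a1 a3, ← digits_inj a2 a4]
      exact ⟨fun h => List.append_inj h (by simp [length_digits]), fun h => by rw [h.1, h.2]⟩
    have ht : [ν.tileIdx u.tile] < [ν.tileIdx v.tile] ↔ ν.tileIdx u.tile < ν.tileIdx v.tile := by
      simp [List.cons_lt_cons_iff]
    rw [happ, ht, ν.tileIdx_lt_tileIdx_iff, ν.prec_iff]
    omega
  refine ⟨⟨?_, ?_, ?_⟩, fun u hu v hv => ⟨?_, hlt u hu v hv⟩⟩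
  · intro v hv
    rw [factored_verts _ _ hk]
    exact ⟨_, append_mem_words (hd _) (hd _), _, singleton_mem_words.2 (ν.tileIdx_lt v.tile), rfl⟩
  -- Injectivity comes from the order: distinct vertices are comparable, so their codes are strictly
  -- ordered.
  · intro u hu v hv h
    rcases ν.prec_trichotomy u v with h' | h' | h'
    · rw [hlt u hu v hv, h] at h'
      exact absurd h' (lt_irrefl _)
    · exact h'
    · rw [hlt v hv u hu, h] at h'
      exact absurd h' (lt_irrefl _)
  · intro w hw
    rw [factored_verts _ _ hk] at hw
    obtain ⟨u, hu, v, hv, rfl⟩ := hw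
    obtain ⟨p, hp, q, hq, rfl⟩ := mem_words_add.1 hu
    obtain ⟨m, hm, rfl⟩ := mem_words_one.1 hv
    obtain ⟨i, hi, rfl⟩ := exists_digits_eq hp
    obtain ⟨j, hj, rfl⟩ := exists_digits_eq hq
    obtain ⟨t, rfl⟩ := ν.exists_tileIdx_eq hm
    exact ⟨⟨i + 1, j + 1, t⟩, ⟨by simp, hi, by simp, hj⟩, rfl⟩
  · have ⟨hu1, hu2, hu3, hu4⟩ := hu
    have ⟨hv1, hv2, hv3, hv4⟩ := hv
    unfold code
    rw [factored_edge ν x hb hk (by omega) (by omega) (by omega) (by omega)]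
    obtain ⟨i, j, t⟩ := u
    obtain ⟨i', j', t'⟩ := v
    simp only at hu1 hu2 hu3 hu4 hv1 hv2 hv3 hv4 ⊢
    refine (and_iff_right hu).trans ((and_iff_right hv).trans ?_)
    refine or_congr ?_ (exists_congr fun D => and_congr_left fun _ => ?_)
    · simp only [ne_eq, Node.mk.injEq]
      constructor
      · rintro ⟨rfl, rfl, h⟩
        exact ⟨rfl, rfl, fun h' => h ⟨rfl, rfl, h'⟩⟩
      · rintro ⟨h1, h2, h⟩
        exact ⟨by omega, by omega, fun h' => h h'.2.2⟩
    · cases D <;> simp only [IsParent] <;> omega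

end TM.Numbering

/-! ### Transport of the LFMIS and correctness of the reduction -/

theorem DGraph.IsOrderedIso.lfmis_eq_image {V W : Type} {G : DGraph V} {lt : V → V → Prop}
    {H : DGraph W} {lt' : W → W → Prop} {φ : V → W} (h : G.IsOrderedIso lt H lt' φ)
    {I : Set V} (hI : G.IsGreedy lt I) (hwf : G.verts.WellFoundedOn lt)
    (htri : ∀ u ∈ G.verts, ∀ v ∈ G.verts, lt u v ∨ u = v ∨ lt v u) :
    H.lfmis lt' = φ '' I := by
  refine (h.isGreedy_image hI).lfmis_eq ?_ ?_
  · rw [← h.1.image_eq, Set.wellFoundedOn_image]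
    exact hwf.mono' fun u hu v hv huv => (h.2 u hu v hv).2.2 huv
  · rw [← h.1.image_eq]
    rintro _ ⟨u, hu, rfl⟩ _ ⟨v, hv, rfl⟩
    rcases htri u hu v hv with h' | h' | h'
    · exact Or.inl ((h.2 u hu v hv).2.1 h')
    · exact Or.inr (Or.inl (congrArg φ h'))
    · exact Or.inr (Or.inr ((h.2 v hv u hu).2.1 h'))

namespace TM

variable {α Q Γ : Type} {M : TM α Q Γ} {x : List α}

/-- Halting at once would leave the first input symbol, which is not blank, in the leftmost cell. -/
theorem Normalized.one_le_of_halting (hM : M.Normalized) (hx : x ≠ []) {s : ℕ} {c : Cfg Q Γ}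
    (hc : M.run x s = some c) (hh : M.Halting c.state) : 1 ≤ s := by
  by_contra hs
  obtain rfl : s = 0 := by omega
  obtain ⟨-, h⟩ := hM x 0 c hc hh
  obtain rfl : M.init x = c := Option.some.inj hc
  obtain ⟨a, y, rfl⟩ := List.exists_cons_of_ne_nil hx
  exact M.inp_ne_blank a h

theorem acceptNode_mem_diagram_iff (hM : M.Normalized) (hx : x ≠ []) {s T : ℕ} (hs : s + 1 ≤ T)
    {cs : Cfg Q Γ} (hcs : M.run x s = some cs) (hh : M.Halting cs.state) {c : ℕ → Cfg Q Γ}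
    (hfin : ∀ i, s ≤ i → c i = cs) :
    M.acceptNode x.length T ∈ diagram x M T c ↔ M.Accepts x := by
  have hs1 := hM.one_le_of_halting hx hcs hh
  obtain ⟨h0, hb⟩ := hM x s cs hcs hh
  -- With `T ≥ 2` the last row is not the first one, so its tiles carry plain states and symbols.
  obtain ⟨i, rfl⟩ := Nat.exists_eq_add_of_le' (show 2 ≤ T by omega)
  have hi : c (i + 1) = cs := hfin _ (by omega)
  have htile : tileAt x M c (i + 2 - 1) (1 - 1) = (.st cs.state, .sym M.blank) := by
    change tileAt x M c (i + 1) 0 = _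
    rw [tileAt_succ, hi, h0, hb, if_pos rfl]
  rw [accepts_iff_of_halting hcs hh]
  constructor
  · rintro ⟨-, h⟩
    have h := h.trans htile
    simp only [acceptNode, Prod.mk.injEq, XState.st.injEq, and_true] at h
    exact h.symm
  · intro h
    refine ⟨⟨?_, le_rfl, le_rfl, ?_⟩, ?_⟩
    · simp only [acceptNode]; omega
    · simp only [acceptNode]; omega
    · exact Eq.trans (by rw [h]; rfl) htile.symm

theorem acceptNode_mem_gridVerts {n T : ℕ} (hT : 1 ≤ T) :
    M.acceptNode n T ∈ gridVerts Q Γ n T := ⟨hT, le_rfl, le_rfl, hT⟩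

variable [Fintype Q] [Fintype Γ] (ν : M.Numbering)

/-- A normalized machine that halts in time accepts exactly if the accepting vertex belongs to the
lexicographically first maximal independent set of the grid graph. -/
theorem accepts_iff_acceptNode_mem_lfmis (hM : M.Normalized) (hx : x ≠ []) {s T : ℕ}
    (hs : s + 1 ≤ T) (hh : M.HaltsAfter x s) :
    M.Accepts x ↔ M.acceptNode x.length T ∈ (M.gridGraph x T).lfmis ν.prec := by
  obtain ⟨cs, hcs, hh⟩ := hh
  obtain ⟨c, hc, hfin⟩ := exists_isFrozenRun hcs hh
  rw [(isGreedy_diagram ν hc hx T).lfmis_eq (ν.prec_wellFounded _).wellFoundedOn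
    fun u _ v _ => ν.prec_trichotomy u v]
  exact (acceptNode_mem_diagram_iff hM hx hs hcs hh hfin).symm

theorem accepts_iff_code_mem_lfmis (hM : M.Normalized) (hx : x ≠ []) {s b k : ℕ} (hb : 2 ≤ b)
    (hk : 1 ≤ k) (hs : s + 1 ≤ b ^ k) (hh : M.HaltsAfter x s) :
    ν.code b k (M.acceptNode x.length (b ^ k)) ∈ (ν.factored x b k).eval.lfmis (· < ·) ↔
      M.Accepts x := by
  obtain ⟨cs, hcs, hh⟩ := hh
  obtain ⟨c, hc, hfin⟩ := exists_isFrozenRun hcs hh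
  have hgr := isGreedy_diagram ν hc hx (b ^ k)
  have hiso := ν.gridGraph_isOrderedIso x hb hk
  rw [hiso.lfmis_eq_image hgr (ν.prec_wellFounded _).wellFoundedOn
    fun u _ v _ => ν.prec_trichotomy u v, ← acceptNode_mem_diagram_iff hM hx hs hcs hh hfin]
  refine ⟨fun ⟨v, hv, h⟩ => ?_, fun h => ⟨_, h, rfl⟩⟩
  have := hiso.1.injOn hv.1 (acceptNode_mem_gridVerts (by omega)) h
  exact this ▸ hv

end TM

/-! ### The number of digits -/

/-- The least power of `b` that is at least `m`. -/
theorem exists_pow_ge_lt {b m : ℕ} (hb : 2 ≤ b) (hm : 2 ≤ m) :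
    ∃ k, m ≤ b ^ (k + 1) ∧ b ^ k < m := by
  have hex : ∃ k, m ≤ b ^ k := ⟨m, (Nat.lt_pow_self (by omega)).le⟩
  classical
  obtain ⟨k, hk⟩ : ∃ k, Nat.find hex = k + 1 := by
    -- The exponent `0` is impossible because `m ≥ 2`.
    refine Nat.exists_eq_succ_of_ne_zero fun h => ?_
    have := Nat.find_spec hex
    rw [h, pow_zero] at this
    omega
  refine ⟨k, hk ▸ Nat.find_spec hex, not_le.1 (Nat.find_min hex (by omega))⟩

/-- The constant is absorbed by `C ≤ b ^ C`, at the price of a bound that depends on `C`. -/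
theorem exponent_lt_of_pow_lt {b n C k ℓ : ℕ} (hb : 2 ≤ b) (hn : n ≤ b) (h : b ^ k < C * n ^ ℓ) :
    k < C + ℓ := by
  refine (Nat.pow_lt_pow_iff_right (show 1 < b by omega)).1 (h.trans_le ?_)
  rw [pow_add]
  exact Nat.mul_le_mul ((Nat.lt_pow_self (by omega)).le) (Nat.pow_le_pow_left hn ℓ)

/-- Once `n ≥ C`, the constant costs only one more factor `n`, which gives a bound free of `C`. -/
theorem exponent_le_of_pow_lt {n C k ℓ : ℕ} (hn : 2 ≤ n) (hC : C ≤ n) (h : n ^ k < C * n ^ ℓ) :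
    k ≤ ℓ := by
  refine Nat.lt_succ_iff.1 ((Nat.pow_lt_pow_iff_right (show 1 < n by omega)).1 (h.trans_le ?_))
  rw [Nat.succ_eq_add_one, pow_succ']
  exact Nat.mul_le_mul_right _ hC

theorem TM.DecidesInTimePow.exists_bound {α Q Γ : Type} {M : TM α Q Γ} {L : Language α} {ℓ : ℕ}
    (h : M.DecidesInTimePow L ℓ) : ∃ C, 2 ≤ C ∧ ∀ x : List α, x ≠ [] →
      ∃ s, s + 1 ≤ C * x.length ^ ℓ ∧ M.HaltsAfter x s := by
  obtain ⟨-, f, hf, hO⟩ := h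
  obtain ⟨c, hc⟩ := hO.bound
  obtain ⟨N, hN⟩ := eventually_atTop.1 hc
  obtain ⟨A, hA⟩ := exists_nat_ge c
  -- `A` serves the lengths from `N` on and the sum the finitely many shorter ones. The summand `2`
  -- pays for counting time steps from `1` and ensures `2 ≤ C`.
  refine ⟨A + (∑ i ∈ Finset.range N, f i) + 2, by omega, fun x hx => ?_⟩
  obtain ⟨s, hs, hh⟩ := hf x
  refine ⟨s, ?_, hh⟩
  have hpos : 1 ≤ x.length ^ ℓ := Nat.one_le_pow _ _ (List.length_pos_iff.2 hx)
  have hfx : f x.length ≤ (A + ∑ i ∈ Finset.range N, f i) * x.length ^ ℓ := by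
    rcases Nat.lt_or_ge x.length N with hlt | hge
    · calc f x.length ≤ ∑ i ∈ Finset.range N, f i :=
            Finset.single_le_sum (fun i _ => Nat.zero_le (f i)) (Finset.mem_range.2 hlt)
        _ ≤ A + ∑ i ∈ Finset.range N, f i := Nat.le_add_left _ _
        _ ≤ _ := Nat.le_mul_of_pos_right _ hpos
    · have h1 := hN _ hge
      simp only [Real.norm_natCast, norm_pow] at h1
      have h2 : (f x.length : ℝ) ≤ ((A * x.length ^ ℓ : ℕ) : ℝ) := by
        push_cast
        exact h1.trans (by gcongr)
      calc f x.length ≤ A * x.length ^ ℓ := by exact_mod_cast h2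
        _ ≤ _ := Nat.mul_le_mul_right _ (Nat.le_add_right _ _)
  rw [add_mul]
  omega

/-- Each of the three terms is at most its coefficient times `(m * ℓ) ^ 2`, and `15 = 6 + 4 + 5`. -/
theorem poly_le_of_le_mul {k m ℓ : ℕ} (hk : k ≤ m * ℓ) (hm : 1 ≤ m * ℓ) :
    6 * k ^ 2 + 4 * k + 5 ≤ 15 * m ^ 2 * ℓ ^ 2 := by
  have h1 : k ^ 2 ≤ (m * ℓ) ^ 2 := Nat.pow_le_pow_left hk 2
  have h2 : m * ℓ ≤ (m * ℓ) ^ 2 := Nat.le_self_pow (by norm_num) _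
  calc _ ≤ 15 * (m * ℓ) ^ 2 := by omega
    _ = _ := by ring

/-! ### Normalization of Turing machines -/

/-- The states of the normalized machine: the start state, the states of the simulated machine, and,
for either answer, the return to the leftmost cell, the last move and the halting state. -/
inductive NormState (Q : Type) where
  | start : NormState Q
  | sim (q : Q) : NormState Q
  | ret (r : Bool) : NormState Q
  | fin (r : Bool) : NormState Q
  | halt (r : Bool) : NormState Q

noncomputable instance {Q : Type} [Fintype Q] : Fintype (NormState Q) :=
  Fintype.ofInjective (β := Option Q ⊕ (Fin 3 × Bool))
    (fun
      | .start => Sum.inl none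
      | .sim q => Sum.inl (some q)
      | .ret r => Sum.inr (0, r)
      | .fin r => Sum.inr (1, r)
      | .halt r => Sum.inr (2, r))
    (by intro p q h; cases p <;> cases q <;> simp_all)

namespace TM

variable {α Q Γ : Type} (M : TM α Q Γ)

open Classical in
/-- The state of the normalized machine after the simulated machine has entered `q`. -/
noncomputable def normNext (q : Q) : NormState Q :=
  if M.Halting q then .ret (decide (q = M.qacc)) else .sim q

open Classical in
/-- A machine that marks the leftmost cell in its first step, simulates `M`, and before halting
returns to the leftmost cell and erases it. -/
noncomputable def normalize : TM α (NormState Q) (Γ × Bool) where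
  δ
    | .start, (a, _) =>
      -- If the start state already halts there is nothing to simulate: the leftmost cell is erased
      -- at once.
      if M.Halting M.q₀ then (.fin (decide (M.q₀ = M.qacc)), (M.blank, false), .R)
      else (M.normNext (M.δ M.q₀ a).1, ((M.δ M.q₀ a).2.1, true), (M.δ M.q₀ a).2.2)
    | .sim q, (a, m) => (M.normNext (M.δ q a).1, ((M.δ q a).2.1, m), (M.δ q a).2.2)
    -- From the marked cell the head must go right, as a left move would fall off the tape; `.fin`
    -- then brings it back and halts.
    | .ret r, (a, m) => if m then (.fin r, (M.blank, false), .R) else (.ret r, (a, m), .L)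
    | .fin r, s => (.halt r, s, .L)
    | .halt r, s => (.halt r, s, .L)
  q₀ := .start
  qacc := .halt true
  qrej := .halt false
  qacc_ne_qrej := by simp
  blank := (M.blank, false)
  inp := ⟨fun a => (M.inp a, false), fun a b h => M.inp.injective (Prod.ext_iff.1 h).1⟩
  inp_ne_blank a h := M.inp_ne_blank a (Prod.ext_iff.1 h).1

/-- The configuration of the normalized machine that corresponds to a configuration of `M`. -/
noncomputable def normCfg (c : Cfg Q Γ) : Cfg (NormState Q) (Γ × Bool) where
  state := M.normNext c.state
  head := c.head
  tape j := (c.tape j, decide (j = 0))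

variable {M} {x : List α}

theorem normalize_halting_iff (p : NormState Q) :
    M.normalize.Halting p ↔ ∃ r, p = .halt r := by
  constructor
  · rintro (rfl | rfl) <;> exact ⟨_, rfl⟩
  · rintro ⟨r, rfl⟩
    cases r
    · exact Or.inr rfl
    · exact Or.inl rfl

/-- The initial tape carries no mark, so it is not of the form `normCfg`; the first step sets the
mark, and the correspondence starts after it. -/
theorem normalize_step_init {c : Cfg Q Γ} (h : M.step (M.init x) = some c) :
    M.normalize.step (M.normalize.init x) = some (M.normCfg c) := by
  obtain ⟨hh, h1, h2, h3⟩ := step_eq_some h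
  have h0 : ∀ j, (M.normalize.init x).tape j = ((M.init x).tape j, false) := fun j => by
    simp only [init]
    cases x[j]? <;> rfl
  have hq : ¬ M.Halting M.q₀ := hh
  have hδ : M.normalize.δ (M.normalize.init x).state
      ((M.normalize.init x).tape (M.normalize.init x).head) =
      (M.normNext c.state, (c.tape 0, true), (M.δ M.q₀ ((M.init x).tape 0)).2.2) := by
    rw [h1, h2, h0]
    refine (if_neg hq).trans ?_
    simp [init]
  refine step_eq_some_of ?_ hδ rfl ?_ h3
  · rw [normalize_halting_iff]
    rintro ⟨r, hr⟩
    cases hr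
  · funext j
    rcases eq_or_ne j 0 with rfl | hj
    · simp [normCfg, init]
    · simp only [normCfg, hj, decide_false]
      rw [Function.update_of_ne (by exact hj), h0, h2, Function.update_of_ne (by exact hj)]

theorem normalize_step_normCfg {c c' : Cfg Q Γ} (h : M.step c = some c') :
    M.normalize.step (M.normCfg c) = some (M.normCfg c') := by
  obtain ⟨hh, h1, h2, h3⟩ := step_eq_some h
  have hst : (M.normCfg c).state = .sim c.state := if_neg hh
  have hδ : M.normalize.δ (M.normCfg c).state ((M.normCfg c).tape (M.normCfg c).head) =
      (M.normNext c'.state, ((M.δ c.state (c.tape c.head)).2.1, decide (c.head = 0)),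
        (M.δ c.state (c.tape c.head)).2.2) := by
    rw [h1, hst]
    rfl
  refine step_eq_some_of ?_ hδ rfl ?_ h3
  · rw [normalize_halting_iff, hst]
    rintro ⟨r, hr⟩
    cases hr
  · funext j
    rcases eq_or_ne j c.head with rfl | hj
    · simp [normCfg, h2]
    · simp [normCfg, h2, hj]

theorem normalize_run_succ {s : ℕ} {c : Cfg Q Γ} (h : M.run x (s + 1) = some c) :
    M.normalize.run x (s + 1) = some (M.normCfg c) := by
  induction s generalizing c with
  | zero => exact normalize_step_init h
  | succ s ih =>
    rw [run] at h
    obtain ⟨d, hd, h⟩ := Option.bind_eq_some_iff.1 h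
    rw [run, ih hd]
    exact normalize_step_normCfg h

theorem normalize_run_fin {s : ℕ} {r : Bool} {t : ℕ → Γ × Bool}
    (h : M.normalize.run x s = some ⟨.fin r, 1, t⟩) :
    M.normalize.run x (s + 1) = some ⟨.halt r, 0, t⟩ := by
  rw [run, h]
  refine step_eq_some_of (q := .halt r) (a := t 1) (d := .L) ?_ rfl rfl ?_ (Or.inr ⟨rfl, rfl⟩)
  · rw [normalize_halting_iff]
    rintro ⟨r, hr⟩
    cases hr
  · simp

/-- The mark on cell `0` alone stops the walk to the left: `h` moves reach it, one step erases and
moves right, one moves back and halts. -/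
theorem normalize_run_ret {s h : ℕ} {r : Bool} {t : ℕ → Γ × Bool}
    (ht : ∀ j, (t j).2 = decide (j = 0)) (hs : M.normalize.run x s = some ⟨.ret r, h, t⟩) :
    M.normalize.run x (s + h + 2) =
      some ⟨.halt r, 0, Function.update t 0 M.normalize.blank⟩ := by
  have hnh : ¬ M.normalize.Halting (.ret r) := by
    rw [normalize_halting_iff]
    rintro ⟨r, hr⟩
    cases hr
  induction h generalizing s with
  | zero =>
    refine normalize_run_fin ?_
    rw [run, hs]
    refine step_eq_some_of (q := .fin r) (a := M.normalize.blank) (d := .R) hnh ?_ rfl rfl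
      (Or.inl ⟨rfl, rfl⟩)
    have h0 := ht 0
    change (if (t 0).2 = true then _ else _) = _
    rw [h0]
    rfl
  | succ h ih =>
    rw [show s + (h + 1) + 2 = (s + 1) + h + 2 by omega]
    refine ih ?_
    rw [run, hs]
    refine step_eq_some_of (q := .ret r) (a := t (h + 1)) (d := .L) hnh ?_ rfl ?_
      (Or.inr ⟨rfl, rfl⟩)
    · have h0 := ht (h + 1)
      change (if (t (h + 1)).2 = true then _ else _) = _
      rw [if_neg (by simp [h0])]
    · simp

theorem normalize_exists_run {s : ℕ} {c : Cfg Q Γ} (hc : M.run x s = some c)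
    (hh : M.Halting c.state) : ∃ s' ≤ 2 * s + 2, ∃ r t,
      M.normalize.run x s' = some ⟨.halt r, 0, t⟩ ∧ t 0 = M.normalize.blank ∧
        (r = true ↔ c.state = M.qacc) := by
  classical
  rcases s with _ | s
  · obtain rfl : M.init x = c := Option.some.inj hc
    -- Here `M` halts without a step, and its counterpart erases the first cell in one step and
    -- returns in the next.
    refine ⟨2, le_rfl, decide (M.q₀ = M.qacc),
      Function.update (M.normalize.init x).tape 0 M.normalize.blank, normalize_run_fin (s := 1) ?_,
      by simp, by simp [init]⟩
    refine step_eq_some_of (q := .fin (decide (M.q₀ = M.qacc))) (a := M.normalize.blank) (d := .R)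
      ?_ ?_ rfl rfl (Or.inl ⟨rfl, rfl⟩)
    · rw [normalize_halting_iff]
      rintro ⟨r, hr⟩
      cases hr
    · exact if_pos hh
  · have h1 := normalize_run_succ hc
    have hle := head_le_of_run hc
    have h2 : M.normCfg c = ⟨.ret (decide (c.state = M.qacc)), c.head,
        fun j => (c.tape j, decide (j = 0))⟩ := by
      simp [normCfg, normNext, hh]
    rw [h2] at h1
    -- After the simulation the head is at most as far right as the number of steps made, so the
    -- return at most doubles the time.
    exact ⟨_, by omega, _, _, normalize_run_ret (fun _ => rfl) h1, by simp, by simp⟩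

/-- Since `M` halts on every input, the new machine has a halting configuration of known shape on
every input, and by `halting_unique` it has no other. -/
theorem DecidesInTimePow.normalize {L : Language α} {ℓ : ℕ} (h : M.DecidesInTimePow L ℓ) :
    M.normalize.Normalized ∧ M.normalize.DecidesInTimePow L ℓ := by
  obtain ⟨hL, f, hf, hO⟩ := h
  have hhalt : ∀ r, M.normalize.Halting (.halt r) := fun r =>
    (normalize_halting_iff _).2 ⟨r, rfl⟩
  refine ⟨fun x s c hc hh => ?_, fun x => ?_, fun n => 2 * f n + 2, fun x => ?_, ?_⟩
  · obtain ⟨s₀, -, c₀, hc₀, hh₀⟩ := hf x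
    obtain ⟨s', -, r, t, hr, ht, -⟩ := normalize_exists_run hc₀ hh₀
    rw [halting_unique hc hh hr (hhalt r)]
    exact ⟨rfl, ht⟩
  · obtain ⟨s₀, -, c₀, hc₀, hh₀⟩ := hf x
    obtain ⟨s', -, r, t, hr, -, hacc⟩ := normalize_exists_run hc₀ hh₀
    rw [hL x, accepts_iff_of_halting hc₀ hh₀, accepts_iff_of_halting hr (hhalt r), ← hacc]
    cases r <;> simp [TM.normalize]
  · obtain ⟨s₀, hs₀, c₀, hc₀, hh₀⟩ := hf x
    obtain ⟨s', hs', r, t, hr, -, -⟩ := normalize_exists_run hc₀ hh₀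
    exact ⟨s', hs'.trans (by simp only; omega), _, hr, hhalt r⟩
  · have h2 : (fun _ : ℕ => (2 : ℝ)) =O[atTop] (fun n : ℕ => (n : ℝ) ^ ℓ) := by
      refine IsBigO.of_bound 2 (eventually_atTop.2 ⟨1, fun n hn => ?_⟩)
      have : (1 : ℝ) ≤ (n : ℝ) ^ ℓ := one_le_pow₀ (by exact_mod_cast hn)
      rw [Real.norm_of_nonneg (by norm_num), Real.norm_of_nonneg (by positivity)]
      linarith
    simpa using (hO.const_mul_left 2).add h2

end TM

end FactoredLFMIS

/-! ### Assembly of the four claims -/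

theorem mainTheorem6 :
    -- the grid graph simulates the machine
    (∀ (α Q Γ : Type) [Fintype Q] [Fintype Γ] (M : FactoredLFMIS.TM α Q Γ) (ν : M.Numbering)
        (x : List α) (T : ℕ),
      M.Normalized → x ≠ [] → (∃ s, s + 1 ≤ T ∧ M.HaltsAfter x s) →
      (M.Accepts x ↔ M.acceptNode x.length T ∈ (M.gridGraph x T).lfmis ν.prec)) ∧
    -- the factored representation of the grid graph
    (∀ (α Q Γ : Type) [Fintype Q] [Fintype Γ] (M : FactoredLFMIS.TM α Q Γ) (ν : M.Numbering)
        (x : List α) (b k : ℕ), 2 ≤ b → 1 ≤ k →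
      (M.gridGraph x (b ^ k)).IsOrderedIso ν.prec (ν.factored x b k).eval (· < ·) (ν.code b k) ∧
      (ν.factored x b k).HasComplexity
        (max b ((Fintype.card Q + 2) * (Fintype.card Γ + x.length))) (6 * k ^ 2 + 4 * k + 5)) ∧
    -- the efficient reduction from a language in `DTIME(n ^ ℓ)`
    (∃ c : ℕ, ∀ (α Q Γ : Type) [Fintype Q] [Fintype Γ] (M : FactoredLFMIS.TM α Q Γ)
        (ν : M.Numbering), M.Normalized → ∃ c₁ : ℕ, ∀ (L : Language α) (ℓ : ℕ),
      1 ≤ ℓ → M.DecidesInTimePow L ℓ →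
      ∃ C c₂ N : ℕ, ∀ x : List α, x ≠ [] →
        ∃ k : ℕ, 1 ≤ k ∧
          C * x.length ^ ℓ ≤ max x.length 2 ^ k ∧
          max x.length 2 ^ k < max x.length 2 * (C * x.length ^ ℓ) ∧
          (∃ s, s + 1 ≤ C * x.length ^ ℓ ∧ M.HaltsAfter x s) ∧
          (∃ n' k' : ℕ, (ν.factored x (max x.length 2) k).HasComplexity n' k' ∧
            n' ≤ c₁ * x.length ∧ k' ≤ c₂ * ℓ ^ 2 ∧ (N ≤ x.length → k' ≤ c * ℓ ^ 2)) ∧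
          ν.code (max x.length 2) k (M.acceptNode x.length (max x.length 2 ^ k)) ∈
            (ν.factored x (max x.length 2) k).eval.verts ∧
          (ν.code (max x.length 2) k (M.acceptNode x.length (max x.length 2 ^ k)) ∈
            (ν.factored x (max x.length 2) k).eval.lfmis (· < ·) ↔ M.Accepts x) ∧
          (M.Accepts x ↔ x ∈ L)) ∧
    -- the normal form of the machine is no restriction on the language
    (∀ (α Q Γ : Type) [Fintype Q] [Fintype Γ] (M : FactoredLFMIS.TM α Q Γ) (L : Language α)
        (ℓ : ℕ), 1 ≤ ℓ → M.DecidesInTimePow L ℓ →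
      ∃ (Q' Γ' : Type) (_ : Fintype Q') (_ : Fintype Γ') (M' : FactoredLFMIS.TM α Q' Γ'),
        M'.Normalized ∧ M'.DecidesInTimePow L ℓ) := by
  refine ⟨?_, ?_, ?_, ?_⟩
  · intro α Q Γ _ _ M ν x T hM hx ⟨s, hs, hh⟩
    exact FactoredLFMIS.TM.accepts_iff_acceptNode_mem_lfmis ν hM hx hs hh
  · intro α Q Γ _ _ M ν x b k hb hk
    exact ⟨ν.gridGraph_isOrderedIso x hb hk, ν.factored_hasComplexity x b hk⟩
  -- `60 = 15 * 2 ^ 2` comes from an exponent of at most `ℓ + 1 ≤ 2 * ℓ`. In the size constant, the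
  -- product bounds the number of tiles per input symbol, and `2` covers `max n 2 ≤ 2 * n`.
  · refine ⟨60, fun α Q Γ _ _ M ν hM =>
      ⟨(Fintype.card Q + 2) * (Fintype.card Γ + 1) + 2, fun L ℓ hℓ hL => ?_⟩⟩
    obtain ⟨C, hC2, hC⟩ := hL.exists_bound
    -- For all lengths the exponent is at most `C + ℓ ≤ (C + 1) * ℓ`. From length `max C 2` on, the
    -- base is the length itself and it absorbs `C`.
    refine ⟨C, 15 * (C + 1) ^ 2, max C 2, fun x hx => ?_⟩
    obtain ⟨s, hs, hh⟩ := hC x hx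
    have hlen : 1 ≤ x.length := List.length_pos_iff.2 hx
    have hb : 2 ≤ max x.length 2 := le_max_right _ _
    have hm : 2 ≤ C * x.length ^ ℓ :=
      hC2.trans (Nat.le_mul_of_pos_right _ (Nat.one_le_pow _ _ hlen))
    obtain ⟨k, hk1, hk2⟩ := FactoredLFMIS.exists_pow_ge_lt hb hm
    have hk : 1 ≤ k + 1 := Nat.le_add_left _ _
    refine ⟨k + 1, hk, hk1, ?_, ⟨s, hs, hh⟩,
      ⟨_, _, ν.factored_hasComplexity x _ hk, ?_, ?_, fun hN => ?_⟩, ?_, ?_, (hL.1 x).symm⟩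
    -- Minimality of the exponent: one digit fewer would not reach the time bound.
    · rw [pow_succ']
      exact Nat.mul_lt_mul_of_pos_left hk2 (by omega)
    · have h1 : (Fintype.card Q + 2) * (Fintype.card Γ + x.length) ≤
          (Fintype.card Q + 2) * (Fintype.card Γ + 1) * x.length := by
        rw [mul_assoc]
        refine Nat.mul_le_mul_left _ ?_
        rw [add_mul, one_mul]
        exact Nat.add_le_add_right (Nat.le_mul_of_pos_right _ hlen) _
      rw [add_mul _ 2 x.length]
      omega
    · have h1 := FactoredLFMIS.exponent_lt_of_pow_lt hb (le_max_left _ _) hk2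
      have h2 : C ≤ C * ℓ := Nat.le_mul_of_pos_right _ hℓ
      exact FactoredLFMIS.poly_le_of_le_mul (m := C + 1) (by rw [add_mul]; omega)
        (by rw [add_mul]; omega)
    · rw [max_eq_left ((le_max_right _ _).trans hN)] at hk2
      have h1 := FactoredLFMIS.exponent_le_of_pow_lt ((le_max_right _ _).trans hN)
        ((le_max_left _ _).trans hN) hk2
      exact FactoredLFMIS.poly_le_of_le_mul (m := 2) (by omega) (by omega)
    · exact (ν.gridGraph_isOrderedIso x hb hk).1.mapsTo
        (FactoredLFMIS.TM.acceptNode_mem_gridVerts (Nat.one_le_pow _ _ (by omega)))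
    · exact FactoredLFMIS.TM.accepts_iff_code_mem_lfmis ν hM hx hb hk (hs.trans hk1) hh
  · intro α Q Γ _ _ M L ℓ _ hL
    exact ⟨_, _, inferInstance, inferInstance, M.normalize, hL.normalize⟩
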